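/- Let $n\ge1$, let $\mathbb B^n$ be the open unit ball of $\mathbb C^n$, and let $d\sigma$ be the normalized surface measure on $\partial\mathbb B^n$, with $\|u\|_{\partial\mathbb B^n}$ the norm of $u$ in $L^2(\partial\mathbb B^n,d\sigma)$. For $s>-1$ let $\|\cdot\|_s$ be the norm in $L^2(\mathbb B^n,d\mu_s)$, where $$d\mu_s(z)=\frac{\Gamma(s+n+1)}{\pi^n\,\Gamma(s+1)}(1-|z|^2)^s\,dz .$$ A function $f:\mathbb B^n\to\mathbb C$ is pluriharmonic if it is $C^2$ and $\partial^2 f/\partial z_j\partial\bar z_k=0$ for all $j,k$. Such an $f$ has a unique decomposition $f=\sum_{p\ge0}f_{p0}+\sum_{q\ge1}f_{0q}$, converging locally uniformly on $\mathbb B^n$, where $f_{p0}$ is a homogeneous polynomial of degree $p$ in $z$ and $f_{0q}$ is a homogeneous polynomial of degree $q$ in $\bar z$. Put $$\|f\|_\circ^2:=\sum_{p=1}^\infty p\,\frac{(n)_p}{p!}\bigl(\|f_{p0}\|^2_{\partial\mathbb B^n}+\|f_{0p}\|^2_{\partial\mathbb B^n}\bigr)\in[0,\infty],\qquad (n)_p=n(n+1)\cdots(n+p-1),$$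 and let the pluriharmonic Dirichlet space $\mathcal M_\circ$ consist of all pluriharmonic $f$ on $\mathbb B^n$ with $\|f\|_\circ<\infty$. Let $\mathcal N:=\sum_{j=1}^n\bigl(z_j\frac{\partial}{\partial z_j}+\bar z_j\frac{\partial}{\partial\bar z_j}\bigr)$ be the radial derivative. Theorem. For a pluriharmonic function $f$ on $\mathbb B^n$ the following are equivalent: (i) $f\in\mathcal M_\circ$; (ii) $\|\mathcal N^m f\|^2_{2m-n-1}<\infty$ for some integer $m>n/2$; (iii) $\|\mathcal N^m f\|^2_{2m-n-1}<\infty$ for every integer $m>n/2$. Furthermore, $\mathcal M_\circ$ is a complex vector space, $\|\cdot\|_\circ$ is a seminorm on it, and for every integer $m>n/2$ the functional $f\mapsto\|\mathcal N^m f\|_{2m-n-1}$ is a seminorm on $\mathcal M_\circ$ equivalent to $\|\cdot\|_\circ$: there are constants $0<c\le C<\infty$, depending only on $n$ and $m$, such that $c\,\|f\|_\circ\le\|\mathcal N^m f\|_{2m-n-1}\le C\,\|f\|_\circ$ for all $f\in\mathcal M_\circ$. -/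

import Mathlib

open MeasureTheory Filter Topology
open scoped ENNReal ComplexConjugate Nat

noncomputable section

/-- Complex `n`-space `ℂⁿ` with its Euclidean norm. -/
abbrev Cn (n : ℕ) : Type := EuclideanSpace ℂ (Fin n)

/-- The open unit ball of `ℂⁿ`. -/
abbrev unitBall (n : ℕ) : Set (Cn n) := Metric.ball 0 1

/-- The standard basis vector `e_j` of `ℂⁿ`. -/
def stdVec (n : ℕ) (j : Fin n) : Cn n := EuclideanSpace.single j (1 : ℂ)

/-- The Wirtinger derivative `∂f/∂z_j = (∂f/∂x_j - i ∂f/∂y_j) / 2`. -/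
def wirtinger (n : ℕ) (j : Fin n) (f : Cn n → ℂ) (z : Cn n) : ℂ :=
  (fderiv ℝ f z (stdVec n j) - Complex.I * fderiv ℝ f z (Complex.I • stdVec n j)) / 2

/-- The Wirtinger derivative `∂f/∂z̄_j = (∂f/∂x_j + i ∂f/∂y_j) / 2`. -/
def wirtingerBar (n : ℕ) (j : Fin n) (f : Cn n → ℂ) (z : Cn n) : ℂ :=
  (fderiv ℝ f z (stdVec n j) + Complex.I * fderiv ℝ f z (Complex.I • stdVec n j)) / 2

/-- `f` is pluriharmonic on the unit ball: it is of class `C²` there and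
`∂²f/∂z_j∂z̄_k = 0` for all `j, k`. Only the values of `f` on the ball matter. -/
def IsPluriharmonic (n : ℕ) (f : Cn n → ℂ) : Prop :=
  ContDiffOn ℝ 2 f (unitBall n) ∧
    ∀ z ∈ unitBall n, ∀ j k : Fin n, wirtinger n j (wirtingerBar n k f) z = 0

/-- The radial derivative `𝒩 f = ∑_j z_j ∂f/∂z_j + z̄_j ∂f/∂z̄_j`. -/
def radialDeriv (n : ℕ) (f : Cn n → ℂ) (z : Cn n) : ℂ :=
  ∑ j : Fin n, (z j * wirtinger n j f z + conj (z j) * wirtingerBar n j f z)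

/-- The measure `dμ_s(z) = Γ(s+n+1) / (π^n Γ(s+1)) (1-|z|²)^s dz` on the unit ball. -/
def bergmanMeasure (n : ℕ) (s : ℝ) : Measure (Cn n) :=
  (volume.restrict (unitBall n)).withDensity fun z =>
    ENNReal.ofReal (Real.Gamma (s + n + 1) / (Real.pi ^ n * Real.Gamma (s + 1)) *
      (1 - ‖z‖ ^ 2) ^ s)

/-- The squared norm `‖g‖²_s` of `L²(𝔹ⁿ, dμ_s)`, with value `∞` allowed. -/
def bergmanNormSq (n : ℕ) (s : ℝ) (g : Cn n → ℂ) : ℝ≥0∞ :=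
  ∫⁻ z, ‖g z‖ₑ ^ 2 ∂(bergmanMeasure n s)

/-- The normalized surface measure `dσ` on the unit sphere of `ℂⁿ`. -/
def sphereMeasure (n : ℕ) : Measure (Metric.sphere (0 : Cn n) 1) :=
  ((volume : Measure (Cn n)).toSphere Set.univ)⁻¹ • (volume : Measure (Cn n)).toSphere

/-- The squared norm of the restriction of `u` to the sphere in `L²(∂𝔹ⁿ, dσ)`. -/
def sphereNormSq (n : ℕ) (u : Cn n → ℂ) : ℝ≥0∞ :=
  ∫⁻ ζ : Metric.sphere (0 : Cn n) 1, ‖u ζ‖ₑ ^ 2 ∂(sphereMeasure n)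

/-- The solid harmonics of bidegree `(p, 0)`: polynomials in `z` homogeneous of degree `p`
(these are automatically harmonic, and Moebius-harmonic). -/
def solidHol (n p : ℕ) : Set (Cn n → ℂ) :=
  {u | ∃ P : MvPolynomial (Fin n) ℂ, P.IsHomogeneous p ∧
    ∀ z, u z = MvPolynomial.eval (fun j => z j) P}

/-- The solid harmonics of bidegree `(0, q)`: polynomials in `z̄` homogeneous of degree `q`. -/
def solidAnti (n q : ℕ) : Set (Cn n → ℂ) :=
  {v | ∃ P : MvPolynomial (Fin n) ℂ, P.IsHomogeneous q ∧
    ∀ z, v z = MvPolynomial.eval (fun j => conj (z j)) P}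

/-- `(u, v)` is the Peter-Weyl decomposition of the pluriharmonic function `f`:
`f = ∑_{p ≥ 0} u_p + ∑_{q ≥ 1} v_q` locally uniformly on the unit ball, with
`u_p = f_{p0}` of bidegree `(p, 0)` and `v_q = f_{0q}` of bidegree `(0, q)`.
The constant term is counted once, as `u_0`. -/
structure IsPeterWeyl (n : ℕ) (f : Cn n → ℂ) (u v : ℕ → Cn n → ℂ) : Prop where
  hol : ∀ p, u p ∈ solidHol n p
  anti : ∀ q, v q ∈ solidAnti n q
  anti_zero : v 0 = 0
  tendsto : TendstoLocallyUniformlyOn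
    (fun (N : ℕ) (z : Cn n) => ∑ p ∈ Finset.range N, (u p z + v p z)) f atTop (unitBall n)

/-- The squared seminorm
`‖f‖²_∘ = ∑_p p (n)_p / p! (‖f_{p0}‖²_{∂𝔹ⁿ} + ‖f_{0p}‖²_{∂𝔹ⁿ})`, with value `∞` allowed, where
`(n)_p = n (n+1) ⋯ (n+p-1)`. The Peter-Weyl decomposition of a function is unique when it
exists, so the infimum is just the value at that decomposition, and is `∞` if there is none. -/
def dirichletNormSq (n : ℕ) (f : Cn n → ℂ) : ℝ≥0∞ :=
  ⨅ (u : ℕ → Cn n → ℂ) (v : ℕ → Cn n → ℂ) (_ : IsPeterWeyl n f u v),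
    ∑' p : ℕ, ENNReal.ofReal ((p : ℝ) * (n.ascFactorial p : ℝ) / (p ! : ℝ)) *
      (sphereNormSq n (u p) + sphereNormSq n (v p))

/-- The pluriharmonic Dirichlet space `ℳ_∘`. -/
def dirichletSpace (n : ℕ) : Set (Cn n → ℂ) :=
  {f | IsPluriharmonic n f ∧ dirichletNormSq n f < ⊤}

/-- The quantity `‖𝒩^m f‖²_{2m-n-1}`. -/
def radialEnergy (n m : ℕ) (f : Cn n → ℂ) : ℝ≥0∞ :=
  bergmanNormSq n (2 * (m : ℝ) - n - 1) ((radialDeriv n)^[m] f)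

end

/-! Both functionals turn out to be weighted `ℓ²` sums of the same numbers `‖f_{p0}‖² + ‖f_{0p}‖²`,
and their weights are comparable uniformly in `p`.

The vanishing of `∂²f/∂z_j∂z̄_k` makes `∂f` a closed form with holomorphic coefficients. Its
primitive `h` on the ball gives `f = h + conj k` with `k` holomorphic too
(`IsPluriharmonic.exists_eq_add_conj`). The Taylor components of `h`, and those of `k` conjugated,
are the Peter-Weyl components of `f`, and `𝒩^m` multiplies the ones of degree `p` by `p^m`.

On the circle through `z`, `f_{p0}` has frequency `p` and `f_{0p}` has frequency `-p`. So the
components are Fourier coefficients of `f`, hence unique (`IsPeterWeyl.unique`). Since `μ_s` is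
rotation invariant, averaging Parseval over circles and using polar coordinates gives the Bergman
norm as a sum over degrees with no cross terms (`bergmanNormSq_eq_tsum`).

For `m > n/2` the exponent `2m-n-1` is a nonnegative integer, and the radial factor is a beta
integral, a constant times `(n-1+p)!/(p+2m-1)!`. Up to constants, the ratio of the energy weight to
the Dirichlet weight is `p! p^(2m-1)/(p+2m-1)!`, which for `p ≥ 1` lies between `(2m)^(-(2m-1))` and
`1`; both weights vanish at `p = 0` (`exists_energyWeight_comparison`). The comparison is made in
`[0,∞]`, so it yields the equivalence of finiteness conditions as well as of seminorms. -/

/-! ### Cauchy estimates and derivatives of holomorphic functions on `ℂⁿ` -/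

/-- One-variable Cauchy estimate on the disc of radius `r/‖v‖` in the complex line through `z` with
direction `v`. -/
lemma norm_fderiv_le_of_closedBall_bound {n : ℕ} {h : Cn n → ℂ} {z : Cn n} {r M : ℝ} (hr : 0 < r)
    (hd : ∀ w ∈ Metric.closedBall z r, DifferentiableAt ℂ h w)
    (hM : ∀ w ∈ Metric.closedBall z r, ‖h w‖ ≤ M) : ‖fderiv ℂ h z‖ ≤ M / r := by
  have hM0 : 0 ≤ M := (norm_nonneg _).trans (hM z (by simp [hr.le]))
  refine ContinuousLinearMap.opNorm_le_bound _ (by positivity) fun v => ?_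
  rcases eq_or_ne v 0 with rfl | hv
  · simp
  have hv' : 0 < ‖v‖ := norm_pos_iff.2 hv
  have hmem : ∀ l : ℂ, ‖l‖ ≤ r / ‖v‖ → z + l • v ∈ Metric.closedBall z r := by
    intro l hl
    rw [le_div_iff₀ hv'] at hl
    simpa [norm_smul] using hl
  have hslice : ∀ l : ℂ, ‖l‖ ≤ r / ‖v‖ →
      HasDerivAt (fun l : ℂ => h (z + l • v)) (fderiv ℂ h (z + l • v) v) l := by
    intro l hl
    have h1 : HasDerivAt (fun l : ℂ => z + l • v) v l := by
      simpa using ((hasDerivAt_id l).smul_const v).const_add z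
    exact (hd _ (hmem l hl)).hasFDerivAt.comp_hasDerivAt l h1
  have key := Complex.norm_deriv_le_of_forall_mem_sphere_norm_le (c := 0) (R := r / ‖v‖) (C := M)
    (f := fun l : ℂ => h (z + l • v)) (by positivity)
    (DifferentiableOn.diffContOnCl (fun l hl => by
      rw [closure_ball _ (by positivity)] at hl
      exact (hslice l (by simpa using hl)).differentiableAt.differentiableWithinAt))
    (fun l hl => hM _ (hmem l (by simpa using (mem_sphere_iff_norm.1 hl).le)))
  rw [(hslice 0 (by simp; positivity)).deriv] at key
  simp only [zero_smul, add_zero] at key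
  refine key.trans (le_of_eq ?_)
  field_simp

/-- Near a point, the derivative along `v` is a Cauchy integral over a circle in that direction; it
depends on `z` through `h` alone and can be differentiated under the integral sign. This lets
inductions on the order of differentiation run. -/
lemma differentiableOn_fderiv_apply {n : ℕ} {h : Cn n → ℂ} {U : Set (Cn n)} (hU : IsOpen U)
    (hh : DifferentiableOn ℂ h U) (v : Cn n) : DifferentiableOn ℂ (fun z => fderiv ℂ h z v) U := by
  intro z₀ hz₀
  refine DifferentiableAt.differentiableWithinAt ?_
  obtain ⟨R, hR, hRU⟩ := Metric.nhds_basis_closedBall.mem_iff.1 (hU.mem_nhds hz₀)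
  have hd : ∀ w ∈ Metric.closedBall z₀ R, DifferentiableAt ℂ h w := fun w hw =>
    (hh w (hRU hw)).differentiableAt (hU.mem_nhds (hRU hw))
  obtain ⟨M, hM⟩ := (isCompact_closedBall z₀ R).exists_bound_of_continuousOn
    (f := h) (fun w hw => (hd w hw).continuousAt.continuousWithinAt)
  have hfd : ∀ z ∈ Metric.ball z₀ (R / 2), ‖fderiv ℂ h z‖ ≤ M / (R / 2) := by
    intro z hz
    have hsub : Metric.closedBall z (R / 2) ⊆ Metric.closedBall z₀ R :=
      Metric.closedBall_subset_closedBall' (by linarith [Metric.mem_ball.1 hz])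
    exact norm_fderiv_le_of_closedBall_bound (by positivity) (fun w hw => hd w (hsub hw))
      (fun w hw => hM w (hsub hw))
  -- For `z` within `R/4` of `z₀`, the circle of radius `ρ` in direction `v` then stays in the
  -- `R/2`-ball, where `fderiv` is bounded. The `+ 1` covers `v = 0`.
  set ρ : ℝ := R / (4 * (‖v‖ + 1)) with hρ
  have hρ0 : 0 < ρ := by positivity
  have hρv : ρ * ‖v‖ < R / 4 := by
    rw [hρ, div_mul_eq_mul_div, div_lt_div_iff₀ (by positivity) (by positivity)]
    nlinarith [norm_nonneg v]
  have hmem : ∀ z ∈ Metric.ball z₀ (R / 4), ∀ l : ℂ, ‖l‖ ≤ ρ →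
      z + l • v ∈ Metric.ball z₀ (R / 2) := by
    intro z hz l hl
    rw [mem_ball_iff_norm] at hz ⊢
    have : ‖l • v‖ ≤ ρ * ‖v‖ := by rw [norm_smul]; gcongr
    calc ‖z + l • v - z₀‖ = ‖(z - z₀) + l • v‖ := by congr 1; abel
      _ ≤ ‖z - z₀‖ + ‖l • v‖ := norm_add_le _ _
      _ < R / 2 := by linarith
  have hballR : Metric.ball z₀ (R / 2) ⊆ Metric.closedBall z₀ R :=
    (Metric.ball_subset_closedBall).trans (Metric.closedBall_subset_closedBall (by linarith))
  have hcirc : ∀ θ : ℝ, ‖circleMap 0 ρ θ‖ ≤ ρ := fun θ => by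
    simp [norm_circleMap_zero, abs_of_pos hρ0]
  -- The Cauchy kernel `dl / l²` in the angular parameter.
  set κ : ℝ → ℂ := fun θ => deriv (circleMap 0 ρ) θ * ((circleMap 0 ρ θ) ^ 2)⁻¹ with hκ
  have hκc : Continuous κ := by
    have : Continuous fun θ : ℝ => ((circleMap 0 ρ θ) ^ 2)⁻¹ :=
      ((continuous_circleMap 0 ρ).pow 2).inv₀ fun θ => by
        simp [circleMap_eq_center_iff, hρ0.ne']
    simp only [hκ, deriv_circleMap]
    exact ((continuous_circleMap 0 ρ).mul continuous_const).mul this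
  have hlin : Continuous fun θ : ℝ => z₀ + circleMap 0 ρ θ • v :=
    continuous_const.add ((continuous_circleMap 0 ρ).smul continuous_const)
  have hcont : ∀ z ∈ Metric.ball z₀ (R / 4),
      Continuous fun θ : ℝ => κ θ * h (z + circleMap 0 ρ θ • v) := by
    intro z hz
    refine hκc.mul (continuous_iff_continuousAt.2 fun θ => ?_)
    refine ContinuousAt.comp (f := fun θ : ℝ => z + circleMap 0 ρ θ • v) (g := h)
      (hd _ (hballR (hmem z hz _ (hcirc θ)))).continuousAt ?_
    exact (continuous_const.add ((continuous_circleMap 0 ρ).smul continuous_const)).continuousAt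
  have hz₀' : Metric.ball z₀ (R / 4) ∈ 𝓝 z₀ := Metric.ball_mem_nhds _ (by positivity)
  have hformula : ∀ z ∈ Metric.ball z₀ (R / 4), fderiv ℂ h z v =
      (2 * Real.pi * Complex.I : ℂ)⁻¹ • ∫ θ in (0 : ℝ)..2 * Real.pi,
        κ θ * h (z + circleMap 0 ρ θ • v) := by
    intro z hz
    have hslice : ∀ l : ℂ, ‖l‖ ≤ ρ →
        HasDerivAt (fun l : ℂ => h (z + l • v)) (fderiv ℂ h (z + l • v) v) l := by
      intro l hl
      have h1 : HasDerivAt (fun l : ℂ => z + l • v) v l := by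
        simpa using ((hasDerivAt_id l).smul_const v).const_add z
      exact (hd _ (hballR (hmem z hz l hl))).hasFDerivAt.comp_hasDerivAt l h1
    have key := (DifferentiableOn.diffContOnCl (f := fun l : ℂ => h (z + l • v))
      (s := Metric.ball (0 : ℂ) ρ) (fun l hl => by
        rw [closure_ball _ hρ0.ne'] at hl
        exact (hslice l (by simpa using hl)).differentiableAt.differentiableWithinAt)
      ).deriv_eq_smul_circleIntegral hρ0
    rw [(hslice 0 (by simpa using hρ0.le)).deriv] at key
    simp only [zero_smul, add_zero] at key
    have h2 : (2 * Real.pi * Complex.I : ℂ) ≠ 0 := Complex.two_pi_I_ne_zero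
    rw [eq_inv_smul_iff₀ h2, ← key, circleIntegral]
    simp [hκ, mul_assoc]
  have hder : DifferentiableAt ℂ (fun z => ∫ θ in (0 : ℝ)..2 * Real.pi,
        κ θ * h (z + circleMap 0 ρ θ • v)) z₀ := by
    refine (intervalIntegral.hasFDerivAt_integral_of_dominated_of_fderiv_le
      (F' := fun z θ => κ θ • fderiv ℂ h (z + circleMap 0 ρ θ • v))
      (bound := fun θ => ‖κ θ‖ * (M / (R / 2))) hz₀' ?_ ?_ ?_ ?_ ?_ ?_).differentiableAt
    · filter_upwards [hz₀'] with z hz using (hcont z hz).aestronglyMeasurable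
    · exact (hcont z₀ (by simp; positivity)).intervalIntegrable _ _
    · exact hκc.aestronglyMeasurable.smul
        ((measurable_fderiv ℂ h).comp hlin.measurable).aestronglyMeasurable
    · refine Eventually.of_forall fun θ _ z hz => ?_
      rw [norm_smul]
      exact mul_le_mul_of_nonneg_left (hfd _ (hmem z hz _ (hcirc θ))) (norm_nonneg _)
    · exact (hκc.norm.mul continuous_const).intervalIntegrable _ _
    · refine Eventually.of_forall fun θ _ z hz => ?_
      have h1 : HasFDerivAt (fun z : Cn n => z + circleMap 0 ρ θ • v)
        (ContinuousLinearMap.id ℂ (Cn n)) z := (hasFDerivAt_id z).add_const _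
      have h2 := (hd _ (hballR (hmem z hz _ (hcirc θ)))).hasFDerivAt.comp z h1
      exact h2.const_mul (κ θ)
  refine (hder.const_smul ((2 * Real.pi * Complex.I : ℂ)⁻¹)).congr_of_eventuallyEq ?_
  filter_upwards [hz₀'] with z hz using hformula z hz

/-! ### Homogeneous polynomials and Taylor components -/

lemma MvPolynomial.IsHomogeneous.eval_const_mul {n p : ℕ} {P : MvPolynomial (Fin n) ℂ}
    (hP : P.IsHomogeneous p) (c : ℂ) (x : Fin n → ℂ) :
    MvPolynomial.eval (fun j => c * x j) P = c ^ p * MvPolynomial.eval x P := by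
  rw [MvPolynomial.eval_eq', MvPolynomial.eval_eq', Finset.mul_sum]
  refine Finset.sum_congr rfl fun d hd => ?_
  have hdeg : ∑ i, d i = p := by
    simpa [Finsupp.weight_apply, Finsupp.sum_fintype] using hP (MvPolynomial.mem_support_iff.1 hd)
  simp only [mul_pow, Finset.prod_mul_distrib, Finset.prod_pow_eq_pow_sum, hdeg]
  ring

lemma solidHol_smul {n p : ℕ} {u : Cn n → ℂ} (hu : u ∈ solidHol n p) (c : ℂ) (z : Cn n) :
    u (c • z) = c ^ p * u z := by
  obtain ⟨P, hP, hu⟩ := hu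
  rw [hu, hu, ← hP.eval_const_mul]
  simp

lemma solidAnti_smul {n p : ℕ} {v : Cn n → ℂ} (hv : v ∈ solidAnti n p) (c : ℂ) (z : Cn n) :
    v (c • z) = conj c ^ p * v z := by
  obtain ⟨P, hP, hv⟩ := hv
  rw [hv, hv, ← hP.eval_const_mul]
  simp

lemma clm_apply_eq_sum {n : ℕ} (A : Cn n →L[ℂ] ℂ) (z : Cn n) :
    A z = ∑ j, z j * A (stdVec n j) := by
  have hzs : z = ∑ j, z j • stdVec n j := by
    ext i
    simp [stdVec, Finset.sum_apply, Pi.single_apply]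
  conv_lhs => rw [hzs]
  simp

/-- The degree `p` homogeneous Taylor component at the origin of a holomorphic function. -/
noncomputable def holComp {n : ℕ} (h : Cn n → ℂ) (p : ℕ) (z : Cn n) : ℂ :=
  (p ! : ℂ)⁻¹ * iteratedDeriv p (fun l : ℂ => h (l • z)) 0

lemma hasDerivAt_slice {n : ℕ} {h : Cn n → ℂ} (hh : DifferentiableOn ℂ h (unitBall n)) {z : Cn n}
    {l : ℂ} (hl : ‖l • z‖ < 1) :
    HasDerivAt (fun l : ℂ => h (l • z)) (fderiv ℂ h (l • z) z) l := by
  have h1 : HasDerivAt (fun l : ℂ => l • z) z l := by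
    simpa using (hasDerivAt_id l).smul_const z
  exact ((hh _ (by simpa using hl)).differentiableAt
    (Metric.isOpen_ball.mem_nhds (by simpa using hl))).hasFDerivAt.comp_hasDerivAt l h1

lemma differentiableOn_slice {n : ℕ} {h : Cn n → ℂ} (hh : DifferentiableOn ℂ h (unitBall n))
    {z : Cn n} {r : ℝ} (hr : r * ‖z‖ < 1) :
    DifferentiableOn ℂ (fun l : ℂ => h (l • z)) (Metric.closedBall 0 r) := fun l hl =>
  (hasDerivAt_slice hh (by
    rw [norm_smul]
    exact lt_of_le_of_lt (by gcongr; simpa using hl) hr)).differentiableAt.differentiableWithinAt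

lemma exists_pos_mul_norm_lt {n : ℕ} (z : Cn n) : ∃ r : ℝ, 0 < r ∧ r * ‖z‖ < 1 :=
  ⟨1 / (‖z‖ + 1), by positivity, by
    rw [div_mul_eq_mul_div, div_lt_one (by positivity)]; linarith⟩

lemma analyticAt_slice {n : ℕ} {h : Cn n → ℂ} (hh : DifferentiableOn ℂ h (unitBall n))
    (z : Cn n) : AnalyticAt ℂ (fun l : ℂ => h (l • z)) 0 := by
  obtain ⟨r, hr, hrz⟩ := exists_pos_mul_norm_lt z
  exact (differentiableOn_slice hh hrz).analyticAt (Metric.closedBall_mem_nhds _ hr)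

lemma hasSum_holComp {n : ℕ} {h : Cn n → ℂ} (hh : DifferentiableOn ℂ h (unitBall n)) {z : Cn n}
    (hz : z ∈ unitBall n) : HasSum (fun p => holComp h p z) (h z) := by
  have hz1 : ‖z‖ < 1 := by simpa using hz
  obtain ⟨r, hr, hrz⟩ : ∃ r : ℝ, 1 < r ∧ r * ‖z‖ < 1 :=
    ⟨2 / (‖z‖ + 1), by rw [lt_div_iff₀ (by positivity)]; linarith, by
      rw [div_mul_eq_mul_div, div_lt_one (by positivity)]; linarith⟩
  have := Complex.hasSum_taylorSeries_on_ball
    ((differentiableOn_slice hh hrz).mono Metric.ball_subset_closedBall) (z := 1)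
    (by simpa using hr)
  simpa [holComp] using this

lemma deriv_slice_eventuallyEq {n : ℕ} {h : Cn n → ℂ} (hh : DifferentiableOn ℂ h (unitBall n))
    (z : Cn n) : deriv (fun l : ℂ => h (l • z)) =ᶠ[𝓝 0]
      fun l => ∑ j, z j * (fun w => fderiv ℂ h w (stdVec n j)) (l • z) := by
  obtain ⟨r, hr, hrz⟩ := exists_pos_mul_norm_lt z
  filter_upwards [Metric.ball_mem_nhds (0 : ℂ) hr] with l hl
  rw [(hasDerivAt_slice hh (by
    rw [norm_smul]
    exact lt_of_le_of_lt (by gcongr; exact (mem_ball_zero_iff.1 hl).le) hrz)).deriv]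
  exact clm_apply_eq_sum _ _

/-- The slice `l ↦ h (l z)` has derivative `∑ z_j (∂_j h)(l z)`, so each differentiation trades one
order for a factor `z_j`; induct on `p` with `h` general. -/
lemma iteratedDeriv_slice_mem_solidHol {n : ℕ} (p : ℕ) {h : Cn n → ℂ}
    (hh : DifferentiableOn ℂ h (unitBall n)) :
    (fun z : Cn n => iteratedDeriv p (fun l : ℂ => h (l • z)) 0) ∈ solidHol n p := by
  induction p generalizing h with
  | zero => exact ⟨MvPolynomial.C (h 0), MvPolynomial.isHomogeneous_C _ _, by simp⟩
  | succ p ih =>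
    have hj : ∀ j, DifferentiableOn ℂ (fun w => fderiv ℂ h w (stdVec n j)) (unitBall n) := fun j =>
      differentiableOn_fderiv_apply Metric.isOpen_ball hh _
    choose P hP hPe using fun j => ih (hj j)
    refine ⟨∑ j, MvPolynomial.X j * P j, MvPolynomial.IsHomogeneous.sum _ _ _ fun j _ => ?_, ?_⟩
    · rw [add_comm]
      exact (MvPolynomial.isHomogeneous_X _ j).mul (hP j)
    · intro z
      change iteratedDeriv (p + 1) (fun l : ℂ => h (l • z)) 0 = _
      rw [iteratedDeriv_succ', (deriv_slice_eventuallyEq hh z).iteratedDeriv_eq,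
        iteratedDeriv_fun_sum]
      · simp only [map_sum, map_mul, MvPolynomial.eval_X]
        refine Finset.sum_congr rfl fun j _ => ?_
        rw [iteratedDeriv_const_mul_field]
        exact congrArg _ (hPe j z)
      · intro j _
        exact (analyticAt_const.mul (analyticAt_slice (hj j) z)).contDiffAt

lemma holComp_mem_solidHol {n : ℕ} (p : ℕ) {h : Cn n → ℂ}
    (hh : DifferentiableOn ℂ h (unitBall n)) : holComp h p ∈ solidHol n p := by
  obtain ⟨P, hP, hPe⟩ := iteratedDeriv_slice_mem_solidHol p hh
  refine ⟨MvPolynomial.C (p ! : ℂ)⁻¹ * P, by simpa using (MvPolynomial.isHomogeneous_C _ _).mul hP,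
    fun z => ?_⟩
  simp [holComp, hPe]

/-- Cauchy estimate on the disc of radius `ρ/r` in the slice through `z`. When `r < ρ` the bound is
geometric and uniform on `‖z‖ ≤ r`, as the Weierstrass M-test needs. -/
lemma norm_holComp_le {n : ℕ} (p : ℕ) {h : Cn n → ℂ} (hh : DifferentiableOn ℂ h (unitBall n))
    {r ρ M : ℝ} (hr : 0 < r) (hρ : 0 < ρ) (hρ1 : ρ < 1)
    (hM : ∀ w ∈ Metric.closedBall (0 : Cn n) ρ, ‖h w‖ ≤ M) {z : Cn n} (hz : ‖z‖ ≤ r) :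
    ‖holComp h p z‖ ≤ M * (r / ρ) ^ p := by
  have hle : ρ / r * ‖z‖ ≤ ρ := by
    calc ρ / r * ‖z‖ ≤ ρ / r * r := by gcongr
      _ = ρ := by field_simp
  have key := Complex.norm_iteratedDeriv_le_of_forall_mem_sphere_norm_le (c := 0) (R := ρ / r)
    (C := M) (f := fun l : ℂ => h (l • z)) p (by positivity)
    (DifferentiableOn.diffContOnCl (by
      rw [closure_ball _ (by positivity)]
      exact differentiableOn_slice hh (hle.trans_lt hρ1)))
    (fun l hl => hM _ (by
      rw [mem_closedBall_zero_iff, norm_smul, mem_sphere_zero_iff_norm.1 hl]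
      exact hle))
  rw [holComp, norm_mul, norm_inv, Complex.norm_natCast, inv_mul_le_iff₀ (by positivity)]
  refine key.trans (le_of_eq ?_)
  rw [div_pow, div_pow]
  field_simp

lemma tendstoLocallyUniformlyOn_holComp {n : ℕ} {h : Cn n → ℂ}
    (hh : DifferentiableOn ℂ h (unitBall n)) :
    TendstoLocallyUniformlyOn (fun (N : ℕ) z => ∑ p ∈ Finset.range N, holComp h p z) h atTop
      (unitBall n) := by
  intro V hV z₀ hz₀
  have hz1 : ‖z₀‖ < 1 := by simpa using hz₀
  obtain ⟨r, hr, hr1⟩ := exists_between hz1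
  obtain ⟨ρ, hρ, hρ1⟩ := exists_between hr1
  have hr0 : 0 < r := (norm_nonneg _).trans_lt hr
  have hρ0 : 0 < ρ := hr0.trans hρ
  have hsub : Metric.closedBall (0 : Cn n) ρ ⊆ unitBall n := Metric.closedBall_subset_ball hρ1
  obtain ⟨M, hM⟩ := (isCompact_closedBall (0 : Cn n) ρ).exists_bound_of_continuousOn
    (f := h) (hh.continuousOn.mono hsub)
  have hu := tendstoUniformlyOn_tsum_nat (f := fun p z => holComp h p z)
    (u := fun p => M * (r / ρ) ^ p) (s := Metric.ball (0 : Cn n) r)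
    ((summable_geometric_of_lt_one (by positivity) ((div_lt_one hρ0).2 hρ)).mul_left M)
    (fun p z hz => norm_holComp_le p hh hr0 hρ0 hρ1 hM (by simpa using (mem_ball_zero_iff.1 hz).le))
  refine ⟨Metric.ball (0 : Cn n) r, mem_nhdsWithin_of_mem_nhds
    (Metric.isOpen_ball.mem_nhds (by simpa using hr)), ?_⟩
  filter_upwards [hu V hV] with N hN z hz
  have := hN z hz
  rwa [(hasSum_holComp hh (Metric.ball_subset_ball hr1.le hz)).tsum_eq] at this

/-! ### Radial derivatives and the splitting `f = h + conj k` -/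

/-- The holomorphic radial derivative. -/
noncomputable def holRadial {n : ℕ} (h : Cn n → ℂ) (z : Cn n) : ℂ := fderiv ℂ h z z

lemma differentiableOn_holRadial {n : ℕ} {h : Cn n → ℂ} (hh : DifferentiableOn ℂ h (unitBall n)) :
    DifferentiableOn ℂ (holRadial h) (unitBall n) := by
  have : holRadial h = fun z => ∑ j, z j * fderiv ℂ h z (stdVec n j) := by
    funext z
    exact clm_apply_eq_sum _ _
  rw [this]
  refine DifferentiableOn.fun_sum fun j _ => ?_
  exact (EuclideanSpace.proj (𝕜 := ℂ) j).differentiable.differentiableOn.mul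
    (differentiableOn_fderiv_apply Metric.isOpen_ball hh _)

lemma holComp_holRadial {n : ℕ} {h : Cn n → ℂ} (hh : DifferentiableOn ℂ h (unitBall n)) (p : ℕ)
    (z : Cn n) : holComp (holRadial h) p z = p * holComp h p z := by
  have h1 : (fun l : ℂ => holRadial h (l • z)) =ᶠ[𝓝 0]
      ((fun l => l) * deriv fun l : ℂ => h (l • z)) := by
    obtain ⟨r, hr, hrz⟩ := exists_pos_mul_norm_lt z
    filter_upwards [Metric.ball_mem_nhds (0 : ℂ) hr] with l hl
    rw [Pi.mul_apply, (hasDerivAt_slice hh (by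
      rw [norm_smul]
      exact lt_of_le_of_lt (by gcongr; exact (mem_ball_zero_iff.1 hl).le) hrz)).deriv, holRadial]
    simp
  rw [holComp, h1.iteratedDeriv_eq,
    iteratedDeriv_mul contDiffAt_fun_id (analyticAt_slice hh z).deriv.contDiffAt]
  rcases p with _ | p
  · simp
  -- Leibniz for `l * (d/dl) h (l z)` at `l = 0`: only the term differentiating the factor `l`
  -- exactly once survives.
  · rw [Finset.sum_eq_single 1]
    · simp [holComp, ← iteratedDeriv_succ']; ring
    · intro b _ hb
      simp [iteratedDeriv_fun_id_zero, hb]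
    · simp

lemma real_clm_apply_eq_sum {n : ℕ} (A : Cn n →L[ℝ] ℂ) (z : Cn n) :
    A z = ∑ j, ((z j).re * A (stdVec n j) + (z j).im * A (Complex.I • stdVec n j)) := by
  have hzs : z = ∑ j, ((z j).re • stdVec n j + (z j).im • (Complex.I • stdVec n j)) := by
    ext i
    simp [stdVec, Finset.sum_apply, Pi.single_apply, Finset.sum_add_distrib]
  conv_lhs => rw [hzs]
  simp

lemma radialDeriv_eq_fderiv (n : ℕ) (f : Cn n → ℂ) (z : Cn n) :
    radialDeriv n f z = fderiv ℝ f z z := by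
  rw [real_clm_apply_eq_sum, radialDeriv]
  refine Finset.sum_congr rfl fun j _ => ?_
  simp only [wirtinger, wirtingerBar]
  have h1 : conj (z j) = (z j).re - (z j).im * Complex.I := by
    apply Complex.ext <;> simp
  rw [h1]
  nth_rewrite 1 [← Complex.re_add_im (z j)]
  linear_combination (-(z j).im * fderiv ℝ f z (Complex.I • stdVec n j)) * Complex.I_sq

/-- A pluriharmonic function on the ball is the sum of a holomorphic and an antiholomorphic one. -/
lemma IsPluriharmonic.exists_eq_add_conj {n : ℕ} {f : Cn n → ℂ} (hf : IsPluriharmonic n f) :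
    ∃ h k : Cn n → ℂ, DifferentiableOn ℂ h (unitBall n) ∧ DifferentiableOn ℂ k (unitBall n) ∧
      k 0 = 0 ∧ ∀ z ∈ unitBall n, f z = h z + conj (k z) := by
  obtain ⟨hf2, hfL⟩ := hf
  have hat : ∀ z ∈ unitBall n, ContDiffAt ℝ 2 f z := fun z hz =>
    hf2.contDiffAt (Metric.isOpen_ball.mem_nhds hz)
  set A : Cn n → Cn n →L[ℝ] ℂ := fderiv ℝ f with hA
  set B : Cn n → Cn n →L[ℝ] Cn n →L[ℝ] ℂ := fderiv ℝ A with hB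
  have hAB : ∀ z ∈ unitBall n, HasFDerivAt A (B z) z := fun z hz =>
    (((hat z hz).fderiv_right (m := 1) (by norm_num)).differentiableAt one_ne_zero).hasFDerivAt
  have hAv : ∀ z ∈ unitBall n, ∀ v, HasFDerivAt (fun z => A z v)
      ((ContinuousLinearMap.apply ℝ ℂ v).comp (B z)) z := fun z hz v =>
    (ContinuousLinearMap.apply ℝ ℂ v).hasFDerivAt.comp z (hAB z hz)
  have hsymm : ∀ z ∈ unitBall n, ∀ v w, B z v w = B z w v := fun z hz v w =>
    (hat z hz).isSymmSndFDerivAt (by simp) v w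
  have hLevi : ∀ z ∈ unitBall n, ∀ j k,
      B z (stdVec n j) (stdVec n k) + Complex.I * B z (stdVec n j) (Complex.I • stdVec n k) -
      Complex.I * (B z (Complex.I • stdVec n j) (stdVec n k) +
        Complex.I * B z (Complex.I • stdVec n j) (Complex.I • stdVec n k)) = 0 := by
    intro z hz j k
    have h1 : HasFDerivAt (wirtingerBar n k f)
        ((2 : ℂ)⁻¹ • ((ContinuousLinearMap.apply ℝ ℂ (stdVec n k)).comp (B z) +
          Complex.I • (ContinuousLinearMap.apply ℝ ℂ (Complex.I • stdVec n k)).comp (B z))) z := by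
      have := ((hAv z hz (stdVec n k)).add
        ((hAv z hz (Complex.I • stdVec n k)).const_mul Complex.I)).const_mul (2 : ℂ)⁻¹
      refine this.congr_of_eventuallyEq (Eventually.of_forall fun w => ?_)
      simp [wirtingerBar, hA, div_eq_inv_mul]
    have h2 := hfL z hz j k
    rw [wirtinger, h1.fderiv] at h2
    simp at h2
    linear_combination 2 * h2
  -- `c j` is `∂f/∂z_j`, the coefficient of `dz_j` in `∂f`.
  set c : Fin n → Cn n → ℂ := fun j z =>
    (A z (stdVec n j) - Complex.I * A z (Complex.I • stdVec n j)) / 2 with hc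
  have hcd : ∀ z ∈ unitBall n, ∀ j, HasFDerivAt (c j)
      ((2 : ℂ)⁻¹ • ((ContinuousLinearMap.apply ℝ ℂ (stdVec n j)).comp (B z) -
          Complex.I • (ContinuousLinearMap.apply ℝ ℂ (Complex.I • stdVec n j)).comp (B z))) z := by
    intro z hz j
    have := ((hAv z hz (stdVec n j)).sub
        ((hAv z hz (Complex.I • stdVec n j)).const_mul Complex.I)).const_mul (2 : ℂ)⁻¹
    refine this.congr_of_eventuallyEq (Eventually.of_forall fun w => ?_)
    simp [hc, div_eq_inv_mul]
  set b : Cn n → Fin n → Fin n → ℂ := fun z i j =>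
    (B z (stdVec n i) (stdVec n j) - Complex.I * B z (stdVec n i) (Complex.I • stdVec n j)) / 2
    with hb
  have hbsymm : ∀ z ∈ unitBall n, ∀ i j, b z i j = b z j i := by
    intro z hz i j
    have h1 := hLevi z hz i j
    have h2 := hLevi z hz j i
    rw [hsymm z hz (stdVec n j), hsymm z hz (stdVec n j), hsymm z hz (Complex.I • stdVec n j),
      hsymm z hz (Complex.I • stdVec n j)] at h2
    simp only [hb]
    rw [hsymm z hz (stdVec n j), hsymm z hz (stdVec n j)]
    linear_combination (1 / 4 : ℂ) * h2 - (1 / 4 : ℂ) * h1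
  -- The mixed-derivative hypothesis makes the real differential of `c j` complex linear: `c j` is
  -- holomorphic, with `∂c_j/∂z_i = b z i j`.
  have hcx : ∀ z ∈ unitBall n, ∀ j x, fderiv ℝ (c j) z x = ∑ i, x i * b z i j := by
    intro z hz j x
    rw [(hcd z hz j).fderiv, real_clm_apply_eq_sum]
    refine Finset.sum_congr rfl fun i _ => ?_
    have h2 := hLevi z hz j i
    rw [hsymm z hz (stdVec n j), hsymm z hz (stdVec n j), hsymm z hz (Complex.I • stdVec n j),
      hsymm z hz (Complex.I • stdVec n j)] at h2
    nth_rewrite 3 [← Complex.re_add_im (x i)]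
    simp only [hb, smul_apply, sub_apply, ContinuousLinearMap.comp_apply,
      ContinuousLinearMap.apply_apply, smul_eq_mul]
    linear_combination (-Complex.I * (x i).im / 2) * h2 + ((x i).im / 2 *
      (B z (Complex.I • stdVec n i) (stdVec n j) -
        Complex.I * B z (Complex.I • stdVec n i) (Complex.I • stdVec n j))) * Complex.I_sq
  set ω : Cn n → Cn n →L[ℂ] ℂ := fun z => ∑ j, c j z • EuclideanSpace.proj (𝕜 := ℂ) j with hω
  have hωd : ∀ z ∈ unitBall n, HasFDerivAt ω (∑ j, (fderiv ℝ (c j) z).smulRight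
      (EuclideanSpace.proj (𝕜 := ℂ) j : Cn n →L[ℂ] ℂ)) z := by
    intro z hz
    refine HasFDerivAt.fun_sum fun j _ => ?_
    exact HasFDerivAt.smul_const (F := Cn n →L[ℂ] ℂ) (𝕜' := ℂ)
      (hcd z hz j).differentiableAt.hasFDerivAt (EuclideanSpace.proj (𝕜 := ℂ) j)
  -- Symmetry of `b` says that `ω = ∂f` is closed, so it has a holomorphic primitive on the convex
  -- ball.
  obtain ⟨h, hh⟩ := (convex_ball (0 : Cn n) 1).exists_forall_hasFDerivAt_of_fderiv_symmetric
    Metric.isOpen_ball (ω := ω) (fun z hz => (hωd z hz).differentiableAt.differentiableWithinAt) (by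
      intro z hz x y
      rw [(hωd z hz).fderiv]
      simp only [sum_apply, ContinuousLinearMap.smulRight_apply, hcx z hz,
        smul_apply, PiLp.proj_apply, smul_eq_mul, Finset.sum_mul]
      rw [Finset.sum_comm]
      refine Finset.sum_congr rfl fun i _ => Finset.sum_congr rfl fun j _ => ?_
      rw [hbsymm z hz]
      ring)
  -- The differential of `f - h` is `∂̄f`, which is conjugate linear; conjugating makes it complex
  -- linear.
  set k : Cn n → ℂ := fun z => conj (f z - h z) with hk
  have hkd : ∀ z ∈ unitBall n, DifferentiableAt ℂ k z := by
    intro z hz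
    have h1 : HasFDerivAt k ((Complex.conjCLE : ℂ →L[ℝ] ℂ).comp
        (A z - (ω z).restrictScalars ℝ)) z :=
      (Complex.conjCLE : ℂ →L[ℝ] ℂ).hasFDerivAt.comp z
        (((hat z hz).differentiableAt two_ne_zero).hasFDerivAt.sub ((hh z hz).restrictScalars ℝ))
    have h2 : HasFDerivAt (𝕜 := ℂ) k (∑ j, conj ((A z (stdVec n j) +
        Complex.I * A z (Complex.I • stdVec n j)) / 2) • EuclideanSpace.proj (𝕜 := ℂ) j) z := by
      refine hasFDerivAt_of_restrictScalars ℝ h1 ?_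
      ext v
      simp [hω, sum_apply, real_clm_apply_eq_sum (A z) v]
      rw [← Finset.sum_sub_distrib]
      refine Finset.sum_congr rfl fun j _ => ?_
      have h3 : conj (v j) = (v j).re - (v j).im * Complex.I := by
        apply Complex.ext <;> simp
      have h4 : conj (c j z) = (conj (A z (stdVec n j)) +
          Complex.I * conj (A z (Complex.I • stdVec n j))) / 2 := by
        simp [hc, map_div₀, Complex.conj_ofNat]
      rw [h3, h4, Complex.conj_ofNat]
      nth_rewrite 1 [← Complex.re_add_im (v j)]
      linear_combination (-(v j).im * conj (A z (Complex.I • stdVec n j))) * Complex.I_sq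
    exact h2.differentiableAt
  -- The constant of `k` is moved into `h`, so that it is counted once.
  refine ⟨fun z => h z + conj (k 0), fun z => k z - k 0, ?_, ?_, by simp, ?_⟩
  · exact fun z hz => ((hh z hz).differentiableAt.add_const _).differentiableWithinAt
  · exact fun z hz => ((hkd z hz).sub_const _).differentiableWithinAt
  · intro z _
    simp [hk]

/-- `f` is the sum of the holomorphic function `h` and the conjugate of the holomorphic function
`k`, which vanishes at the origin. -/
structure IsHolAddConj (n : ℕ) (f h k : Cn n → ℂ) : Prop where
  hol : DifferentiableOn ℂ h (unitBall n)
  hol_conj : DifferentiableOn ℂ k (unitBall n)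
  conj_zero : k 0 = 0
  eq_add : ∀ z ∈ unitBall n, f z = h z + conj (k z)

namespace IsHolAddConj

variable {n : ℕ} {f h k : Cn n → ℂ}

lemma hasFDerivAt (H : IsHolAddConj n f h k) {z : Cn n} (hz : z ∈ unitBall n) :
    HasFDerivAt f ((fderiv ℂ h z).restrictScalars ℝ +
      (Complex.conjCLE : ℂ →L[ℝ] ℂ).comp ((fderiv ℂ k z).restrictScalars ℝ)) z := by
  have hU : unitBall n ∈ 𝓝 z := Metric.isOpen_ball.mem_nhds hz
  have h1 := (H.hol.differentiableAt hU).hasFDerivAt.restrictScalars ℝ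
  have h2 := (Complex.conjCLE : ℂ →L[ℝ] ℂ).hasFDerivAt.comp z
    ((H.hol_conj.differentiableAt hU).hasFDerivAt.restrictScalars ℝ)
  refine (h1.add h2).congr_of_eventuallyEq ?_
  filter_upwards [hU] with w hw
  simp [H.eq_add w hw]

lemma continuousOn (H : IsHolAddConj n f h k) : ContinuousOn f (unitBall n) := fun _ hz =>
  (H.hasFDerivAt hz).continuousAt.continuousWithinAt

lemma radialDeriv (H : IsHolAddConj n f h k) :
    IsHolAddConj n (radialDeriv n f) (holRadial h) (holRadial k) where
  hol := differentiableOn_holRadial H.hol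
  hol_conj := differentiableOn_holRadial H.hol_conj
  conj_zero := by simp [holRadial]
  eq_add z hz := by
    rw [radialDeriv_eq_fderiv, (H.hasFDerivAt hz).fderiv]
    simp [holRadial]

lemma iterate_radialDeriv (H : IsHolAddConj n f h k) (m : ℕ) :
    IsHolAddConj n ((_root_.radialDeriv n)^[m] f) (holRadial^[m] h) (holRadial^[m] k) := by
  induction m with
  | zero => exact H
  | succ m ih =>
    simp only [Function.iterate_succ_apply']
    exact ih.radialDeriv

lemma isPeterWeyl (H : IsHolAddConj n f h k) :
    IsPeterWeyl n f (holComp h) (fun p z => conj (holComp k p z)) where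
  hol p := holComp_mem_solidHol p H.hol
  anti q := by
    obtain ⟨P, hP, hPe⟩ := holComp_mem_solidHol q H.hol_conj
    refine ⟨MvPolynomial.map (starRingEnd ℂ) P, hP.map _, fun z => ?_⟩
    simp only [hPe, MvPolynomial.eval_map]
    rw [MvPolynomial.eval, MvPolynomial.coe_eval₂Hom, MvPolynomial.hom_eval₂]
    rfl
  anti_zero := by
    funext z
    simp [holComp, H.conj_zero]
  tendsto := by
    have h1 := tendstoLocallyUniformlyOn_holComp H.hol
    have h2 := tendstoLocallyUniformlyOn_holComp H.hol_conj
    have h3 : TendstoLocallyUniformlyOn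
        (fun (N : ℕ) z => conj (∑ p ∈ Finset.range N, holComp k p z)) (fun z => conj (k z)) atTop
        (unitBall n) :=
      Complex.isometry_conj.uniformContinuous.comp_tendstoLocallyUniformlyOn h2
    refine ((h1.add h3).congr fun N z _ => ?_).congr_right fun z hz => ?_
    · simp [Finset.sum_add_distrib]
    · simp [H.eq_add z hz]

end IsHolAddConj

lemma IsPluriharmonic.exists_isHolAddConj {n : ℕ} {f : Cn n → ℂ} (hf : IsPluriharmonic n f) :
    ∃ h k, IsHolAddConj n f h k := by
  obtain ⟨h, k, h1, h2, h3, h4⟩ := hf.exists_eq_add_conj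
  exact ⟨h, k, h1, h2, h3, h4⟩

lemma differentiableOn_iterate_holRadial {n : ℕ} {h : Cn n → ℂ}
    (hh : DifferentiableOn ℂ h (unitBall n)) (m : ℕ) :
    DifferentiableOn ℂ (holRadial^[m] h) (unitBall n) := by
  induction m with
  | zero => exact hh
  | succ m ih =>
    rw [Function.iterate_succ_apply']
    exact differentiableOn_holRadial ih

lemma holComp_iterate_holRadial {n : ℕ} {h : Cn n → ℂ} (hh : DifferentiableOn ℂ h (unitBall n))
    (m p : ℕ) (z : Cn n) : holComp (holRadial^[m] h) p z = (p : ℂ) ^ m * holComp h p z := by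
  induction m with
  | zero => simp
  | succ m ih =>
    rw [Function.iterate_succ_apply', holComp_holRadial (differentiableOn_iterate_holRadial hh m),
      ih]
    ring

/-! ### Fourier analysis on circles through points of the ball -/

section Fourier

variable {n : ℕ} {f : Cn n → ℂ} {u v : ℕ → Cn n → ℂ}

lemma circle_smul_mem_unitBall {z : Cn n} (hz : z ∈ unitBall n) (t : UnitAddCircle) :
    ((AddCircle.toCircle t : Circle) : ℂ) • z ∈ unitBall n := by
  rw [mem_ball_zero_iff, norm_smul, Circle.norm_coe, one_mul]
  exact mem_ball_zero_iff.1 hz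

/-- The restriction of a function to the circle through `z`. -/
noncomputable def circleSlice (f : Cn n → ℂ) (z : Cn n) (t : UnitAddCircle) : ℂ :=
  f (((AddCircle.toCircle t : Circle) : ℂ) • z)

lemma continuous_circle_smul (z : Cn n) :
    Continuous fun t : UnitAddCircle => ((AddCircle.toCircle t : Circle) : ℂ) • z :=
  (continuous_subtype_val.comp AddCircle.continuous_toCircle).smul continuous_const

lemma continuous_circleSlice (hf : ContinuousOn f (unitBall n)) {z : Cn n} (hz : z ∈ unitBall n) :
    Continuous (circleSlice f z) :=
  hf.comp_continuous (continuous_circle_smul z) fun t => circle_smul_mem_unitBall hz t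

lemma circleSlice_sum_eq (H : IsPeterWeyl n f u v) (N : ℕ) (z : Cn n) :
    circleSlice (fun z => ∑ p ∈ Finset.range N, (u p z + v p z)) z =
      ∑ p ∈ Finset.range N,
        (u p z • ⇑(fourier (T := 1) (p : ℤ)) + v p z • ⇑(fourier (T := 1) (-p : ℤ))) := by
  funext t
  simp only [circleSlice, Finset.sum_apply, Pi.add_apply, Pi.smul_apply, smul_eq_mul]
  refine Finset.sum_congr rfl fun p _ => ?_
  rw [solidHol_smul (H.hol p), solidAnti_smul (H.anti p), fourier_neg]
  simp only [fourier_apply, natCast_zsmul, AddCircle.toCircle_nsmul,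
    Circle.coe_pow, map_pow]
  ring

lemma fourierCoeff_circleSlice_sum (H : IsPeterWeyl n f u v) (N : ℕ) (z : Cn n) (j : ℤ) :
    fourierCoeff (circleSlice (fun z => ∑ p ∈ Finset.range N, (u p z + v p z)) z) j =
      ∑ p ∈ Finset.range N,
        ((if j = p then u p z else 0) + (if j = -p then v p z else 0)) := by
  have hint : ∀ (c : ℂ) (i : ℤ), Integrable (c • ⇑(fourier (T := 1) i)) AddCircle.haarAddCircle :=
    fun c i => ((fourier i).continuous.const_smul c).integrable_of_hasCompactSupport
      (HasCompactSupport.of_compactSpace _)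
  rw [circleSlice_sum_eq H, fourierCoeff.sum _ _ fun p _ => (hint _ _).add (hint _ _),
    Finset.sum_apply]
  refine Finset.sum_congr rfl fun p _ => ?_
  rw [fourierCoeff.add (hint _ _) (hint _ _), Pi.add_apply, fourierCoeff.const_smul,
    fourierCoeff.const_smul, fourierCoeff_fourier, fourierCoeff_fourier]
  simp [Pi.single_apply]

/-- Locally uniform convergence is uniform on the circle through `z`, which is compact, so Fourier
coefficients pass to the limit. -/
lemma tendsto_fourierCoeff_circleSlice (H : IsPeterWeyl n f u v)
    (hf : ContinuousOn f (unitBall n)) {z : Cn n} (hz : z ∈ unitBall n) (j : ℤ) :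
    Tendsto (fun N => fourierCoeff
      (circleSlice (fun z => ∑ p ∈ Finset.range N, (u p z + v p z)) z) j) atTop
      (𝓝 (fourierCoeff (circleSlice f z) j)) := by
  have hunif : TendstoUniformly (fun N => circleSlice
      (fun z => ∑ p ∈ Finset.range N, (u p z + v p z)) z) (circleSlice f z) atTop := by
    have h1 := (tendstoLocallyUniformlyOn_iff_forall_isCompact Metric.isOpen_ball).1 H.tendsto
      (Set.range fun t : UnitAddCircle => ((AddCircle.toCircle t : Circle) : ℂ) • z)
      (by rintro _ ⟨t, rfl⟩; exact circle_smul_mem_unitBall hz t)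
      (isCompact_range (continuous_circle_smul z))
    intro V hV
    filter_upwards [h1 V hV] with N hN t using hN _ ⟨t, rfl⟩
  have hcont := continuous_circleSlice hf hz
  obtain ⟨C, hC⟩ := isCompact_univ.exists_bound_of_continuousOn hcont.continuousOn
  refine tendsto_integral_filter_of_norm_le_const (Eventually.of_forall fun N => ?_)
    ⟨C + 1, ?_⟩ (Eventually.of_forall fun t => (hunif.tendsto_at t).const_smul _)
  · rw [circleSlice_sum_eq H]
    refine Continuous.aestronglyMeasurable ((fourier (-j)).continuous.smul ?_)
    rw [Finset.sum_fn]
    exact continuous_finsetSum _ fun p _ => ((fourier _).continuous.const_smul _).add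
      ((fourier _).continuous.const_smul _)
  · filter_upwards [Metric.tendstoUniformly_iff.1 hunif 1 one_pos] with N hN
    refine Eventually.of_forall fun t => ?_
    have h1 := hN t
    rw [dist_eq_norm, norm_sub_rev] at h1
    have h2 : ‖(fourier (-j) : C(UnitAddCircle, ℂ)) t‖ = 1 := Circle.norm_coe _
    rw [norm_smul, h2, one_mul]
    have h3 := norm_add_le (circleSlice f z t) (circleSlice
      (fun z => ∑ p ∈ Finset.range N, (u p z + v p z)) z t - circleSlice f z t)
    rw [add_sub_cancel] at h3
    linarith [hC t trivial]

lemma fourierCoeff_circleSlice_natCast (H : IsPeterWeyl n f u v)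
    (hf : ContinuousOn f (unitBall n)) {z : Cn n} (hz : z ∈ unitBall n) (p : ℕ) :
    fourierCoeff (circleSlice f z) p = u p z := by
  refine tendsto_nhds_unique (tendsto_fourierCoeff_circleSlice H hf hz p)
    (tendsto_const_nhds.congr' ?_)
  filter_upwards [eventually_gt_atTop p] with N hN
  rw [fourierCoeff_circleSlice_sum H, Finset.sum_eq_single_of_mem p (by simpa using hN)]
  · rcases p with _ | p
    -- At frequency `0` both indicators fire; `v 0 = 0` removes the duplicate.
    · simp [H.anti_zero]
    · rw [if_pos rfl, if_neg (by omega), add_zero]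
  · intro q _ hq
    rw [if_neg (by omega)]
    rcases q with _ | q
    · simp [H.anti_zero]
    · rw [if_neg (by omega), add_zero]

lemma fourierCoeff_circleSlice_neg (H : IsPeterWeyl n f u v)
    (hf : ContinuousOn f (unitBall n)) {z : Cn n} (hz : z ∈ unitBall n) (p : ℕ) :
    fourierCoeff (circleSlice f z) (-(p + 1)) = v (p + 1) z := by
  refine tendsto_nhds_unique (tendsto_fourierCoeff_circleSlice H hf hz _)
    (tendsto_const_nhds.congr' ?_)
  filter_upwards [eventually_gt_atTop (p + 1)] with N hN
  rw [fourierCoeff_circleSlice_sum H, Finset.sum_eq_single_of_mem (p + 1) (by simpa using hN)]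
  · rw [if_neg (by omega), if_pos (by push_cast; rfl), zero_add]
  · intro q _ hq
    rw [if_neg (by omega), if_neg (by omega), add_zero]

lemma lintegral_sq_enorm_eq_tsum_fourierCoeff {g : UnitAddCircle → ℂ} (hg : Continuous g) :
    ∫⁻ t, ‖g t‖ₑ ^ 2 ∂AddCircle.haarAddCircle = ∑' j : ℤ, ‖fourierCoeff g j‖ₑ ^ 2 := by
  set F : Lp ℂ 2 (AddCircle.haarAddCircle (T := 1)) :=
    ContinuousMap.toLp 2 AddCircle.haarAddCircle ℂ ⟨g, hg⟩
  have hF : F =ᵐ[AddCircle.haarAddCircle] g := ContinuousMap.coeFn_toLp _ _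
  have hcoef : fourierCoeff F = fourierCoeff g := fourierCoeff_congr_ae hF
  have h1 := hasSum_sq_fourierCoeff F
  rw [hcoef] at h1
  have h2 : ∫ t, ‖F t‖ ^ 2 ∂AddCircle.haarAddCircle = ∫ t, ‖g t‖ ^ 2 ∂AddCircle.haarAddCircle :=
    integral_congr_ae (by filter_upwards [hF] with t ht using by rw [ht])
  rw [h2] at h1
  have hint : Integrable (fun t => ‖g t‖ ^ 2) (AddCircle.haarAddCircle (T := 1)) :=
    (hg.norm.pow 2).integrable_of_hasCompactSupport (HasCompactSupport.of_compactSpace _)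
  have he : ∀ w : ℂ, ‖w‖ₑ ^ 2 = ENNReal.ofReal (‖w‖ ^ 2) := fun w => by
    rw [ENNReal.ofReal_pow (norm_nonneg _), ofReal_norm]
  simp only [he]
  rw [← ofReal_integral_eq_lintegral_ofReal hint (Eventually.of_forall fun t => by positivity),
    ← h1.tsum_eq, ENNReal.ofReal_tsum_of_nonneg (fun _ => by positivity) h1.summable]

/-- Parseval's identity on circles. -/
lemma lintegral_circleSlice (H : IsPeterWeyl n f u v)
    (hf : ContinuousOn f (unitBall n)) {z : Cn n} (hz : z ∈ unitBall n) :
    ∫⁻ t, ‖circleSlice f z t‖ₑ ^ 2 ∂AddCircle.haarAddCircle =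
      ∑' p, (‖u p z‖ₑ ^ 2 + ‖v p z‖ₑ ^ 2) := by
  rw [lintegral_sq_enorm_eq_tsum_fourierCoeff (continuous_circleSlice hf hz),
    tsum_of_nat_of_neg_add_one ENNReal.summable ENNReal.summable, ENNReal.tsum_add]
  simp only [fourierCoeff_circleSlice_natCast H hf hz, fourierCoeff_circleSlice_neg H hf hz]
  congr 1
  -- Negative frequencies start at `-1`; since `v 0 = 0`, the sum over `v` may start at `0`.
  rw [tsum_eq_zero_add' (f := fun p => ‖v p z‖ₑ ^ 2) ENNReal.summable]
  simp [H.anti_zero]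

end Fourier

/-! ### Bergman norms as sums over degrees -/

/-- The density of `bergmanMeasure`, as a function of the radius. -/
noncomputable def bergmanWeight (n : ℕ) (s r : ℝ) : ℝ≥0∞ :=
  ENNReal.ofReal (Real.Gamma (s + n + 1) / (Real.pi ^ n * Real.Gamma (s + 1)) * (1 - r ^ 2) ^ s)

lemma measurable_bergmanWeight (n : ℕ) (s : ℝ) : Measurable (bergmanWeight n s) := by
  unfold bergmanWeight
  fun_prop

lemma bergmanNormSq_eq (n : ℕ) (s : ℝ) (g : Cn n → ℂ) :
    bergmanNormSq n s g = ∫⁻ z in unitBall n, bergmanWeight n s ‖z‖ * ‖g z‖ₑ ^ 2 := by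
  rw [bergmanNormSq, bergmanMeasure]
  exact lintegral_withDensity_eq_lintegral_mul_non_measurable _
    ((measurable_bergmanWeight n s).comp measurable_norm)
    (Eventually.of_forall fun _ => ENNReal.ofReal_lt_top) _

/-- Multiplication by a unimodular scalar, as a real linear isometry. -/
noncomputable def circleRotation (n : ℕ) (c : Circle) : Cn n ≃ₗᵢ[ℝ] Cn n where
  toLinearEquiv := LinearEquiv.ofBijective
    { toFun := fun z => (c : ℂ) • z
      map_add' := smul_add _
      map_smul' := fun r z => smul_comm _ _ _ }
    ⟨smul_right_injective _ c.coe_ne_zero, fun z => ⟨(c : ℂ)⁻¹ • z, smul_inv_smul₀ c.coe_ne_zero z⟩⟩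
  norm_map' z := by
    change ‖(c : ℂ) • z‖ = ‖z‖
    rw [norm_smul, Circle.norm_coe, one_mul]

lemma setLIntegral_unitBall_circle_smul {n : ℕ} (c : Circle) (F : Cn n → ℝ≥0∞) :
    ∫⁻ z in unitBall n, F ((c : ℂ) • z) = ∫⁻ z in unitBall n, F z := by
  have h := (circleRotation n c).measurePreserving.setLIntegral_comp_preimage_emb
    (circleRotation n c).toHomeomorph.measurableEmbedding F (unitBall n)
  rw [← h]
  congr 2
  ext z
  simp

lemma aemeasurable_circle_smul {n : ℕ} {g : Cn n → ℂ} (hg : ContinuousOn g (unitBall n)) :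
    AEMeasurable (fun q : UnitAddCircle × Cn n => circleSlice g q.2 q.1)
      ((AddCircle.haarAddCircle (T := 1)).prod (volume.restrict (unitBall n))) := by
  have h1 : ContinuousOn (fun q : UnitAddCircle × Cn n => circleSlice g q.2 q.1)
      (Set.univ ×ˢ unitBall n) := by
    refine hg.comp (f := fun q : UnitAddCircle × Cn n =>
      ((AddCircle.toCircle q.1 : Circle) : ℂ) • q.2) ?_ ?_
    · exact (((continuous_subtype_val.comp AddCircle.continuous_toCircle).comp
        continuous_fst).smul continuous_snd).continuousOn
    · exact fun q hq => circle_smul_mem_unitBall hq.2 q.1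
  have h2 := h1.aemeasurable (μ := (AddCircle.haarAddCircle (T := 1)).prod volume)
    (MeasurableSet.univ.prod measurableSet_ball)
  rwa [← Measure.prod_restrict, Measure.restrict_univ] at h2

lemma continuous_of_mem_solidHol {n p : ℕ} {u : Cn n → ℂ} (hu : u ∈ solidHol n p) :
    Continuous u := by
  obtain ⟨P, _, hu⟩ := hu
  rw [funext hu]
  exact (MvPolynomial.continuous_eval P).comp (PiLp.continuous_ofLp 2 _)

lemma continuous_of_mem_solidAnti {n p : ℕ} {v : Cn n → ℂ} (hv : v ∈ solidAnti n p) :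
    Continuous v := by
  obtain ⟨P, _, hv⟩ := hv
  rw [funext hv]
  refine (MvPolynomial.continuous_eval P).comp (continuous_pi fun j => ?_)
  exact Complex.continuous_conj.comp (EuclideanSpace.proj (𝕜 := ℂ) j).continuous

/-- Rotating `g` does not change the integral, so it may be averaged over the circle group. After
Tonelli, Parseval on each circle removes the cross terms. -/
lemma bergmanNormSq_eq_tsum_setLIntegral {n : ℕ} (s : ℝ) {g : Cn n → ℂ} {u v : ℕ → Cn n → ℂ}
    (H : IsPeterWeyl n g u v) (hg : ContinuousOn g (unitBall n)) :
    bergmanNormSq n s g = ∑' p, ((∫⁻ z in unitBall n, bergmanWeight n s ‖z‖ * ‖u p z‖ₑ ^ 2) +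
      ∫⁻ z in unitBall n, bergmanWeight n s ‖z‖ * ‖v p z‖ₑ ^ 2) := by
  have hW : Measurable fun z : Cn n => bergmanWeight n s ‖z‖ :=
    (measurable_bergmanWeight n s).comp measurable_norm
  have hrot : ∀ t : UnitAddCircle, ∫⁻ z in unitBall n,
      bergmanWeight n s ‖z‖ * ‖circleSlice g z t‖ₑ ^ 2 = bergmanNormSq n s g := by
    intro t
    have := setLIntegral_unitBall_circle_smul (AddCircle.toCircle t)
      (fun z : Cn n => bergmanWeight n s ‖z‖ * ‖g z‖ₑ ^ 2)
    simp only [norm_smul, Circle.norm_coe, one_mul] at this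
    rw [bergmanNormSq_eq, ← this]
    rfl
  have h1 : bergmanNormSq n s g = ∫⁻ t, ∫⁻ z in unitBall n,
      bergmanWeight n s ‖z‖ * ‖circleSlice g z t‖ₑ ^ 2 ∂volume
        ∂AddCircle.haarAddCircle (T := 1) := by
    simp [hrot]
  rw [h1, lintegral_lintegral_swap
    ((hW.comp measurable_snd).aemeasurable.mul ((aemeasurable_circle_smul hg).enorm.pow_const 2))]
  have hu : ∀ p, Measurable fun z => bergmanWeight n s ‖z‖ * ‖u p z‖ₑ ^ 2 := fun p =>
    hW.mul ((continuous_of_mem_solidHol (H.hol p)).measurable.enorm.pow_const 2)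
  have hv : ∀ p, Measurable fun z => bergmanWeight n s ‖z‖ * ‖v p z‖ₑ ^ 2 := fun p =>
    hW.mul ((continuous_of_mem_solidAnti (H.anti p)).measurable.enorm.pow_const 2)
  simp_rw [← lintegral_add_left (hu _)]
  rw [← lintegral_tsum (f := fun p z => bergmanWeight n s ‖z‖ * ‖u p z‖ₑ ^ 2 +
    bergmanWeight n s ‖z‖ * ‖v p z‖ₑ ^ 2) fun p => ((hu p).add (hv p)).aemeasurable]
  refine setLIntegral_congr_fun measurableSet_ball fun z hz => ?_
  rw [lintegral_const_mul _ (by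
    have := (continuous_circleSlice hg hz).measurable
    fun_prop), lintegral_circleSlice H hg hz, ← ENNReal.tsum_mul_left]
  simp_rw [mul_add]

/-- The radial factor of the Bergman norm of a homogeneous function of degree `p`. -/
noncomputable def radialFactor (n : ℕ) (s : ℝ) (p : ℕ) : ℝ≥0∞ :=
  ∫⁻ r in Set.Ioo (0 : ℝ) 1,
    ENNReal.ofReal (r ^ (2 * n - 1)) * (bergmanWeight n s r * ENNReal.ofReal (r ^ (2 * p)))

lemma lintegral_eq_polar {n : ℕ} (hn : 1 ≤ n) {G : Cn n → ℝ≥0∞}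
    {A : Metric.sphere (0 : Cn n) 1 → ℝ≥0∞} {B : ℝ → ℝ≥0∞} (hA : Measurable A) (hB : Measurable B)
    (hG : ∀ (ζ : Metric.sphere (0 : Cn n) 1) (r : ℝ), 0 < r → G (r • (ζ : Cn n)) = A ζ * B r) :
    ∫⁻ z, G z = (∫⁻ ζ, A ζ ∂(volume : Measure (Cn n)).toSphere) *
      ∫⁻ r in Set.Ioi (0 : ℝ), ENNReal.ofReal (r ^ (2 * n - 1)) * B r := by
  have : Nonempty (Fin n) := ⟨⟨0, hn⟩⟩
  have hdim : Module.finrank ℝ (Cn n) = 2 * n := by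
    rw [finrank_real_of_complex, finrank_euclideanSpace, Fintype.card_fin]
  have h1 := (volume : Measure (Cn n)).measurePreserving_homeomorphUnitSphereProd.lintegral_comp_emb
    (Homeomorph.measurableEmbedding _) (fun q => A q.1 * B q.2)
  have h2 : ∫⁻ z, G z = ∫⁻ x : ({(0 : Cn n)}ᶜ : Set (Cn n)), G x ∂(volume.comap Subtype.val) := by
    rw [lintegral_subtype_comap (measurableSet_singleton _).compl, restrict_compl_singleton]
  rw [h2]
  calc _ = _ := lintegral_congr fun x => ?_
    _ = _ := h1
    _ = _ := ?_
  · rw [← hG _ _ (homeomorphUnitSphereProd (Cn n) x).2.2]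
    congr 1
    exact (congrArg Subtype.val ((homeomorphUnitSphereProd (Cn n)).symm_apply_apply x)).symm
  · rw [lintegral_prod_mul (g := fun r : Set.Ioi (0 : ℝ) => B r) hA.aemeasurable
      (hB.comp measurable_subtype_coe).aemeasurable]
    congr 1
    rw [hdim, Measure.volumeIoiPow, lintegral_withDensity_eq_lintegral_mul _
      (f := fun r : Set.Ioi (0 : ℝ) => ENNReal.ofReal ((r : ℝ) ^ (2 * n - 1))) (by fun_prop)
      (g := fun r : Set.Ioi (0 : ℝ) => B r) (hB.comp measurable_subtype_coe)]
    exact lintegral_subtype_comap measurableSet_Ioi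
      (fun r : ℝ => ENNReal.ofReal (r ^ (2 * n - 1)) * B r)

/-- Homogeneity separates radius and angle in polar coordinates. The total mass of `toSphere`
appears because `sphereNormSq` uses the normalized measure. -/
lemma setLIntegral_bergmanWeight_homogeneous {n : ℕ} (hn : 1 ≤ n) (s : ℝ) (p : ℕ) {u : Cn n → ℂ}
    (hc : Continuous u)
    (hu : ∀ (r : ℝ) (z : Cn n), 0 < r → ‖u (r • z)‖ₑ = ENNReal.ofReal r ^ p * ‖u z‖ₑ) :
    ∫⁻ z in unitBall n, bergmanWeight n s ‖z‖ * ‖u z‖ₑ ^ 2 =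
      (volume : Measure (Cn n)).toSphere Set.univ * radialFactor n s p * sphereNormSq n u := by
  have : Nonempty (Fin n) := ⟨⟨0, hn⟩⟩
  rw [← lintegral_indicator measurableSet_ball,
    lintegral_eq_polar hn (A := fun ζ => ‖u ζ‖ₑ ^ 2) (B := (Set.Iio (1 : ℝ)).indicator fun r =>
      bergmanWeight n s r * ENNReal.ofReal (r ^ (2 * p)))
      ((hc.comp continuous_subtype_val).measurable.enorm.pow_const 2)
      (((measurable_bergmanWeight n s).mul (by fun_prop)).indicator measurableSet_Iio)]
  · rw [sphereNormSq, sphereMeasure, lintegral_smul_measure, radialFactor]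
    have h0 : (volume : Measure (Cn n)).toSphere Set.univ ≠ 0 := by
      rw [Ne, Measure.measure_univ_eq_zero]
      exact Measure.toSphere_ne_zero _
    have hT : (volume : Measure (Cn n)).toSphere Set.univ ≠ ⊤ := measure_ne_top _ _
    have h3 : ∀ r : ℝ, ENNReal.ofReal (r ^ (2 * n - 1)) * (Set.Iio (1 : ℝ)).indicator (fun r =>
        bergmanWeight n s r * ENNReal.ofReal (r ^ (2 * p))) r = (Set.Iio (1 : ℝ)).indicator
        (fun r => ENNReal.ofReal (r ^ (2 * n - 1)) *
          (bergmanWeight n s r * ENNReal.ofReal (r ^ (2 * p)))) r := by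
      intro r
      by_cases hr : r < 1 <;> simp [hr]
    simp_rw [h3]
    rw [lintegral_indicator measurableSet_Iio, Measure.restrict_restrict measurableSet_Iio,
      Set.inter_comm, Set.Ioi_inter_Iio, smul_eq_mul]
    calc _ = ((volume : Measure (Cn n)).toSphere Set.univ *
          ((volume : Measure (Cn n)).toSphere Set.univ)⁻¹) * _ := by
            rw [ENNReal.mul_inv_cancel h0 hT, one_mul]
      _ = _ := by ring
  · intro ζ r hr
    have hζ : ‖(ζ : Cn n)‖ = 1 := by simp
    have hnorm : ‖r • (ζ : Cn n)‖ = r := by rw [norm_smul, hζ, mul_one, Real.norm_of_nonneg hr.le]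
    by_cases hr1 : r < 1
    · rw [Set.indicator_of_mem (by rw [mem_ball_zero_iff, hnorm]; exact hr1),
        Set.indicator_of_mem (by exact hr1), hnorm, hu r _ hr, ENNReal.ofReal_pow hr.le]
      ring
    · rw [Set.indicator_of_notMem (by rw [mem_ball_zero_iff, hnorm]; exact hr1),
        Set.indicator_of_notMem (by exact hr1), mul_zero]

lemma enorm_solidHol_smul {n p : ℕ} {u : Cn n → ℂ} (hu : u ∈ solidHol n p) (r : ℝ) (z : Cn n)
    (hr : 0 < r) : ‖u (r • z)‖ₑ = ENNReal.ofReal r ^ p * ‖u z‖ₑ := by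
  have := solidHol_smul hu (r : ℂ) z
  rw [Complex.coe_smul] at this
  rw [this, enorm_mul, enorm_pow, ← ofReal_norm (r : ℂ), Complex.norm_real,
    Real.norm_of_nonneg hr.le]

lemma enorm_solidAnti_smul {n p : ℕ} {v : Cn n → ℂ} (hv : v ∈ solidAnti n p) (r : ℝ) (z : Cn n)
    (hr : 0 < r) : ‖v (r • z)‖ₑ = ENNReal.ofReal r ^ p * ‖v z‖ₑ := by
  have := solidAnti_smul hv (r : ℂ) z
  rw [Complex.coe_smul, Complex.conj_ofReal] at this
  rw [this, enorm_mul, enorm_pow, ← ofReal_norm (r : ℂ), Complex.norm_real,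
    Real.norm_of_nonneg hr.le]

lemma bergmanNormSq_eq_tsum {n : ℕ} (hn : 1 ≤ n) (s : ℝ) {g : Cn n → ℂ} {u v : ℕ → Cn n → ℂ}
    (H : IsPeterWeyl n g u v) (hg : ContinuousOn g (unitBall n)) :
    bergmanNormSq n s g = ∑' p, (volume : Measure (Cn n)).toSphere Set.univ * radialFactor n s p *
      (sphereNormSq n (u p) + sphereNormSq n (v p)) := by
  rw [bergmanNormSq_eq_tsum_setLIntegral s H hg]
  refine tsum_congr fun p => ?_
  rw [setLIntegral_bergmanWeight_homogeneous hn s p (continuous_of_mem_solidHol (H.hol p))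
      (enorm_solidHol_smul (H.hol p)),
    setLIntegral_bergmanWeight_homogeneous hn s p (continuous_of_mem_solidAnti (H.anti p))
      (enorm_solidAnti_smul (H.anti p)), mul_add]

/-! ### Beta integrals and comparison of weights -/

/-- Half a beta integral; expanding one factor `1 - r ^ 2` reduces `k + 1` to `k` at `a` and `a +
1`. -/
lemma integral_pow_mul_one_sub_sq_pow (a k : ℕ) :
    ∫ r in (0 : ℝ)..1, r ^ (2 * a + 1) * (1 - r ^ 2) ^ k =
      (a ! * k ! : ℝ) / (2 * (a + k + 1)!) := by
  induction k generalizing a with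
  | zero =>
    have h : (a ! : ℝ) ≠ 0 := by positivity
    simp [integral_pow, Nat.factorial_succ]
    field_simp
    ring
  | succ k ih =>
    have h1 : ∀ r : ℝ, r ^ (2 * a + 1) * (1 - r ^ 2) ^ (k + 1) =
        r ^ (2 * a + 1) * (1 - r ^ 2) ^ k - r ^ (2 * (a + 1) + 1) * (1 - r ^ 2) ^ k := fun r => by
      ring
    simp_rw [h1]
    rw [intervalIntegral.integral_sub (Continuous.intervalIntegrable (by fun_prop) _ _)
      (Continuous.intervalIntegrable (by fun_prop) _ _), ih, ih,
      show a + 1 + k + 1 = (a + k + 1) + 1 by ring, show a + (k + 1) + 1 = (a + k + 1) + 1 by ring,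
      Nat.factorial_succ (a + k + 1), Nat.factorial_succ a, Nat.factorial_succ k]
    have h2 : ((a + k + 1)! : ℝ) ≠ 0 := by positivity
    push_cast
    have h3 : (a + k + 1 + 1 : ℝ) ≠ 0 := by positivity
    field_simp
    ring

lemma exists_radialFactor_eq (N k : ℕ) : ∃ K : ℝ, 0 < K ∧ ∀ p,
    radialFactor (N + 1) k p = ENNReal.ofReal (K * ((N + p)! / (N + p + k + 1)!)) := by
  set K : ℝ := Real.Gamma ((k : ℝ) + (N + 1 : ℕ) + 1) /
    (Real.pi ^ (N + 1) * Real.Gamma ((k : ℝ) + 1)) with hK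
  have hK0 : 0 < K := div_pos (Real.Gamma_pos_of_pos (by positivity))
    (mul_pos (by positivity) (Real.Gamma_pos_of_pos (by positivity)))
  refine ⟨K * (k ! / 2), by positivity, fun p => ?_⟩
  have h1 : ∀ r ∈ Set.Ioo (0 : ℝ) 1, ENNReal.ofReal (r ^ (2 * (N + 1) - 1)) *
      (bergmanWeight (N + 1) k r * ENNReal.ofReal (r ^ (2 * p))) =
      ENNReal.ofReal (K * (r ^ (2 * (N + p) + 1) * (1 - r ^ 2) ^ k)) := by
    intro r hr
    have hr0 := hr.1
    have hr1 : 0 ≤ 1 - r ^ 2 := by nlinarith [hr.1, hr.2]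
    rw [bergmanWeight, ← hK, Real.rpow_natCast, ← ENNReal.ofReal_mul (by positivity),
      ← ENNReal.ofReal_mul (by positivity)]
    congr 1
    rw [show 2 * (N + 1) - 1 = 2 * N + 1 by omega]
    ring
  rw [radialFactor, setLIntegral_congr_fun measurableSet_Ioo h1, restrict_Ioo_eq_restrict_Ioc,
    ← ofReal_integral_eq_lintegral_ofReal, ← intervalIntegral.integral_of_le zero_le_one,
    intervalIntegral.integral_const_mul, integral_pow_mul_one_sub_sq_pow]
  · congr 1
    have : ((N + p + k + 1)! : ℝ) ≠ 0 := by positivity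
    field_simp
  · exact (Continuous.integrableOn_Icc (by fun_prop)).mono_set Set.Ioc_subset_Icc_self
  · filter_upwards [ae_restrict_mem measurableSet_Ioc] with r hr
    have hr0 := hr.1
    have hr1 : 0 ≤ 1 - r ^ 2 := by nlinarith [hr.1, hr.2]
    simp only [Pi.zero_apply]
    positivity

/-- The weight of the degree `p` components in `dirichletNormSq`. -/
noncomputable def dirichletWeight (n p : ℕ) : ℝ :=
  (p : ℝ) * (n.ascFactorial p : ℝ) / (p ! : ℝ)

lemma dirichletWeight_succ (N p : ℕ) :
    dirichletWeight (N + 1) p = p * (N + p)! / (N ! * p !) := by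
  have h := Nat.factorial_mul_ascFactorial N p
  have h0 : (N ! : ℝ) ≠ 0 := by positivity
  rw [dirichletWeight, ← h]
  push_cast
  field_simp

/-- Amounts to `p! p^M ≤ (p+M)!`: each of the `M` extra factors is at least `p`. -/
lemma factorial_quotient_le_dirichletWeight (N M p : ℕ) :
    ((N + p)! / (p + M)! : ℝ) * p ^ (M + 1) ≤ N ! * dirichletWeight (N + 1) p := by
  rcases p with _ | p
  · simp [dirichletWeight_succ]
  have h : (p + 1)! * (p + 1) ^ M ≤ (p + 1 + M)! :=
    (Nat.mul_le_mul_left _ (Nat.pow_le_pow_left (by omega) _)).trans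
      (Nat.factorial_mul_pow_le_factorial (n := M) (m := p + 1))
  have h' : ((p + 1)! : ℝ) * ((p + 1 : ℕ) : ℝ) ^ M ≤ (p + 1 + M)! := by exact_mod_cast h
  rw [dirichletWeight_succ, div_mul_eq_mul_div, mul_div_assoc', div_le_div_iff₀ (by positivity)
    (by positivity)]
  calc ((N + (p + 1))! : ℝ) * ((p + 1 : ℕ) : ℝ) ^ (M + 1) * (N ! * (p + 1)!)
      = N ! * (((p + 1 : ℕ) : ℝ) * (N + (p + 1))!) * ((p + 1)! * ((p + 1 : ℕ) : ℝ) ^ M) := by ring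
    _ ≤ _ := by gcongr

/-- Each of the `M` extra factors of `(p+M)!` is at most `p + M ≤ (M+1) p` when `p ≥ 1`; at `p = 0`
both sides vanish. -/
lemma dirichletWeight_le_factorial_quotient (N M p : ℕ) :
    N ! / (M + 1 : ℝ) ^ M * dirichletWeight (N + 1) p ≤
      ((N + p)! / (p + M)! : ℝ) * p ^ (M + 1) := by
  rcases p with _ | p
  · simp [dirichletWeight_succ]
  have h : (p + 1 + M)! ≤ (p + 1)! * ((M + 1) * (p + 1)) ^ M := by
    rw [← Nat.factorial_mul_ascFactorial]
    refine Nat.mul_le_mul_left _ ((Nat.ascFactorial_le_pow_add _ _).trans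
      (Nat.pow_le_pow_left ?_ _))
    nlinarith
  have h' : ((p + 1 + M)! : ℝ) ≤ (p + 1)! * ((M + 1 : ℝ) * ((p + 1 : ℕ) : ℝ)) ^ M := by
    exact_mod_cast h
  rw [dirichletWeight_succ, div_mul_div_comm, div_mul_eq_mul_div, div_le_div_iff₀ (by positivity)
    (by positivity)]
  calc (N ! : ℝ) * (((p + 1 : ℕ) : ℝ) * (N + (p + 1))!) * (p + 1 + M)!
      ≤ N ! * (((p + 1 : ℕ) : ℝ) * (N + (p + 1))!) *
        ((p + 1)! * ((M + 1 : ℝ) * ((p + 1 : ℕ) : ℝ)) ^ M) := by gcongr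
    _ = _ := by rw [mul_pow]; ring

/-! ### Uniqueness of components and weighted sums of their norms -/

section PeterWeyl

variable {n : ℕ} {f g : Cn n → ℂ} {u v u' v' : ℕ → Cn n → ℂ}

/-- Fourier coefficients only see the ball, while the sphere norms need boundary values; homogeneity
carries equality outward. -/
lemma eq_of_eqOn_unitBall_of_homogeneous {u u' : Cn n → ℂ} {a : ℂ → ℂ} (ha : ∀ c, c ≠ 0 → a c ≠ 0)
    (hu : ∀ c z, u (c • z) = a c * u z) (hu' : ∀ c z, u' (c • z) = a c * u' z)
    (h : Set.EqOn u u' (unitBall n)) : u = u' := by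
  funext z
  obtain ⟨r, hr, hrz⟩ := exists_pos_mul_norm_lt z
  have hr' : (r : ℂ) ≠ 0 := by exact_mod_cast hr.ne'
  have h1 := h (x := (r : ℂ) • z) (by
    rw [mem_ball_zero_iff, norm_smul, Complex.norm_real, Real.norm_of_nonneg hr.le]; exact hrz)
  rw [hu, hu'] at h1
  exact mul_left_cancel₀ (ha _ hr') h1

lemma IsPeterWeyl.unique (H : IsPeterWeyl n f u v) (H' : IsPeterWeyl n f u' v')
    (hf : ContinuousOn f (unitBall n)) : u = u' ∧ v = v' := by
  constructor
  · funext p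
    refine eq_of_eqOn_unitBall_of_homogeneous (a := fun c => c ^ p) (fun c hc => pow_ne_zero _ hc)
      (solidHol_smul (H.hol p)) (solidHol_smul (H'.hol p)) fun z hz => ?_
    rw [← fourierCoeff_circleSlice_natCast H hf hz, fourierCoeff_circleSlice_natCast H' hf hz]
  · funext p
    rcases p with _ | p
    · rw [H.anti_zero, H'.anti_zero]
    refine eq_of_eqOn_unitBall_of_homogeneous (a := fun c => conj c ^ (p + 1))
      (fun c hc => pow_ne_zero _ (by simpa using hc))
      (solidAnti_smul (H.anti _)) (solidAnti_smul (H'.anti _)) fun z hz => ?_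
    rw [← fourierCoeff_circleSlice_neg H hf hz, fourierCoeff_circleSlice_neg H' hf hz]

lemma IsPeterWeyl.add (H : IsPeterWeyl n f u v) (H' : IsPeterWeyl n g u' v') :
    IsPeterWeyl n (f + g) (u + u') (v + v') where
  hol p := by
    obtain ⟨P, hP, hu⟩ := H.hol p
    obtain ⟨Q, hQ, hu'⟩ := H'.hol p
    exact ⟨P + Q, hP.add hQ, fun z => by simp [hu, hu']⟩
  anti p := by
    obtain ⟨P, hP, hu⟩ := H.anti p
    obtain ⟨Q, hQ, hu'⟩ := H'.anti p
    exact ⟨P + Q, hP.add hQ, fun z => by simp [hu, hu']⟩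
  anti_zero := by simp [H.anti_zero, H'.anti_zero]
  tendsto := by
    refine (H.tendsto.add H'.tendsto).congr fun N z _ => ?_
    simp only [Pi.add_apply, ← Finset.sum_add_distrib]
    exact Finset.sum_congr rfl fun _ _ => by ring

lemma IsPeterWeyl.const_smul (H : IsPeterWeyl n f u v) (c : ℂ) :
    IsPeterWeyl n (c • f) (c • u) (c • v) where
  hol p := by
    obtain ⟨P, hP, hu⟩ := H.hol p
    exact ⟨MvPolynomial.C c * P, by simpa using (MvPolynomial.isHomogeneous_C _ _).mul hP,
      fun z => by simp [hu]⟩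
  anti p := by
    obtain ⟨P, hP, hu⟩ := H.anti p
    exact ⟨MvPolynomial.C c * P, by simpa using (MvPolynomial.isHomogeneous_C _ _).mul hP,
      fun z => by simp [hu]⟩
  anti_zero := by simp [H.anti_zero]
  tendsto := by
    have h1 := (uniformContinuous_const_smul (M := ℂ) (X := ℂ) c).comp_tendstoLocallyUniformlyOn
      H.tendsto
    refine h1.congr fun N z _ => ?_
    simp [mul_add, Finset.mul_sum]

/-- The weighted sum of the squared norms on the sphere of the components `u p` and `v p`. -/
noncomputable def weightedNormSq (n : ℕ) (a : ℕ → ℝ≥0∞) (u v : ℕ → Cn n → ℂ) : ℝ≥0∞ :=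
  ∑' p, a p * (sphereNormSq n (u p) + sphereNormSq n (v p))

lemma dirichletNormSq_eq (H : IsPeterWeyl n f u v) (hf : ContinuousOn f (unitBall n)) :
    dirichletNormSq n f = weightedNormSq n (fun p => ENNReal.ofReal (dirichletWeight n p)) u v := by
  refine le_antisymm (iInf_le_of_le u (iInf_le_of_le v (iInf_le_of_le H le_rfl))) ?_
  refine le_iInf fun u' => le_iInf fun v' => le_iInf fun H' => ?_
  obtain ⟨rfl, rfl⟩ := H.unique H' hf
  exact le_rfl

lemma sphereNormSq_const_mul (c : ℂ) (u : Cn n → ℂ) :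
    sphereNormSq n (fun z => c * u z) = ‖c‖ₑ ^ 2 * sphereNormSq n u := by
  simp only [sphereNormSq, enorm_mul, mul_pow]
  exact lintegral_const_mul' _ _ (by finiteness)

/-- A form of the triangle inequality that is linear in the squares, so it survives integration and
weighted summation with values in `[0,∞]`. -/
lemma enorm_add_sq_le (x y : ℂ) {t : ℝ} (ht : 0 < t) :
    ‖x + y‖ₑ ^ 2 ≤ ENNReal.ofReal (1 + t) * ‖x‖ₑ ^ 2 + ENNReal.ofReal (1 + t⁻¹) * ‖y‖ₑ ^ 2 := by
  have he : ∀ w : ℂ, ‖w‖ₑ ^ 2 = ENNReal.ofReal (‖w‖ ^ 2) := fun w => by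
    rw [ENNReal.ofReal_pow (norm_nonneg _), ofReal_norm]
  rw [he, he, he, ← ENNReal.ofReal_mul (by positivity), ← ENNReal.ofReal_mul (by positivity),
    ← ENNReal.ofReal_add (by positivity) (by positivity)]
  refine ENNReal.ofReal_le_ofReal ?_
  have h1 : ‖x + y‖ ^ 2 ≤ (‖x‖ + ‖y‖) ^ 2 := by gcongr; exact norm_add_le x y
  have h2 : (1 + t) * ‖x‖ ^ 2 + (1 + t⁻¹) * ‖y‖ ^ 2 - (‖x‖ + ‖y‖) ^ 2 =
      t⁻¹ * (t * ‖x‖ - ‖y‖) ^ 2 := by field_simp; ring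
  have h3 : 0 ≤ t⁻¹ * (t * ‖x‖ - ‖y‖) ^ 2 := by positivity
  linarith

lemma sphereNormSq_add_le {u u' : Cn n → ℂ} (hu : Continuous u) {t : ℝ} (ht : 0 < t) :
    sphereNormSq n (u + u') ≤ ENNReal.ofReal (1 + t) * sphereNormSq n u +
      ENNReal.ofReal (1 + t⁻¹) * sphereNormSq n u' := by
  simp only [sphereNormSq]
  rw [← lintegral_const_mul' _ _ ENNReal.ofReal_ne_top, ← lintegral_const_mul' _ _
    ENNReal.ofReal_ne_top, ← lintegral_add_left]
  · exact lintegral_mono fun z => enorm_add_sq_le _ _ ht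
  · exact measurable_const.mul
      ((hu.comp continuous_subtype_val).measurable.enorm.pow_const 2)

lemma weightedNormSq_add_le (a : ℕ → ℝ≥0∞) (H : IsPeterWeyl n f u v) {t : ℝ} (ht : 0 < t) :
    weightedNormSq n a (u + u') (v + v') ≤ ENNReal.ofReal (1 + t) * weightedNormSq n a u v +
      ENNReal.ofReal (1 + t⁻¹) * weightedNormSq n a u' v' := by
  simp only [weightedNormSq]
  rw [← ENNReal.tsum_mul_left, ← ENNReal.tsum_mul_left, ← ENNReal.tsum_add]
  refine ENNReal.tsum_le_tsum fun p => ?_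
  calc _ ≤ a p * ((ENNReal.ofReal (1 + t) * sphereNormSq n (u p) +
        ENNReal.ofReal (1 + t⁻¹) * sphereNormSq n (u' p)) +
        (ENNReal.ofReal (1 + t) * sphereNormSq n (v p) +
        ENNReal.ofReal (1 + t⁻¹) * sphereNormSq n (v' p))) := by
        gcongr
        · exact sphereNormSq_add_le (continuous_of_mem_solidHol (H.hol p)) ht
        · exact sphereNormSq_add_le (continuous_of_mem_solidAnti (H.anti p)) ht
    _ = _ := by ring

lemma weightedNormSq_const_smul (a : ℕ → ℝ≥0∞) (c : ℂ) (u v : ℕ → Cn n → ℂ) :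
    weightedNormSq n a (c • u) (c • v) = ‖c‖ₑ ^ 2 * weightedNormSq n a u v := by
  simp only [weightedNormSq]
  rw [← ENNReal.tsum_mul_left]
  refine tsum_congr fun p => ?_
  have h1 := sphereNormSq_const_mul c (u p)
  have h2 := sphereNormSq_const_mul c (v p)
  rw [show (c • u) p = fun z => c * u p z from rfl, show (c • v) p = fun z => c * v p z from rfl,
    h1, h2]
  ring

lemma weightedNormSq_le_mul {a b : ℕ → ℝ≥0∞} {C : ℝ≥0∞} (h : ∀ p, a p ≤ C * b p)
    (u v : ℕ → Cn n → ℂ) : weightedNormSq n a u v ≤ C * weightedNormSq n b u v := by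
  simp only [weightedNormSq]
  rw [← ENNReal.tsum_mul_left]
  refine ENNReal.tsum_le_tsum fun p => ?_
  rw [← mul_assoc]
  gcongr
  exact h p

/-- The weight of the degree `p` components in `radialEnergy`. -/
noncomputable def energyWeight (n m p : ℕ) : ℝ≥0∞ :=
  (volume : Measure (Cn n)).toSphere Set.univ * radialFactor n (2 * (m : ℝ) - n - 1) p *
    ENNReal.ofReal ((p : ℝ) ^ (2 * m))

/-- By uniqueness the given components are the Taylor ones, which `𝒩^m` scales by `p ^ m`. -/
lemma radialEnergy_eq (hn : 1 ≤ n) (m : ℕ) (hf : IsPluriharmonic n f) (H : IsPeterWeyl n f u v) :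
    radialEnergy n m f = weightedNormSq n (energyWeight n m) u v := by
  obtain ⟨h, k, Hf⟩ := hf.exists_isHolAddConj
  obtain ⟨rfl, rfl⟩ := H.unique Hf.isPeterWeyl Hf.continuousOn
  have Hm := Hf.iterate_radialDeriv m
  rw [radialEnergy, bergmanNormSq_eq_tsum hn _ Hm.isPeterWeyl Hm.continuousOn, weightedNormSq]
  refine tsum_congr fun p => ?_
  have h1 : holComp (holRadial^[m] h) p = fun z => (p : ℂ) ^ m * holComp h p z :=
    funext fun z => holComp_iterate_holRadial Hf.hol m p z
  have h2 : (fun z => conj (holComp (holRadial^[m] k) p z)) =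
      fun z => (p : ℂ) ^ m * conj (holComp k p z) :=
    funext fun z => by simp [holComp_iterate_holRadial Hf.hol_conj m p z]
  have h3 : ‖(p : ℂ) ^ m‖ₑ ^ 2 = ENNReal.ofReal ((p : ℝ) ^ (2 * m)) := by
    rw [← ofReal_norm, ← ENNReal.ofReal_pow (norm_nonneg _), norm_pow, Complex.norm_natCast,
      ← pow_mul, mul_comm]
  rw [h1, h2, sphereNormSq_const_mul, sphereNormSq_const_mul, energyWeight, h3]
  ring

end PeterWeyl

lemma exists_energyWeight_comparison {n m : ℕ} (hn : 1 ≤ n) (hm : (n : ℝ) / 2 < m) :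
    ∃ c C : ℝ, 0 < c ∧ 0 < C ∧ ∀ p,
      ENNReal.ofReal (dirichletWeight n p) ≤ ENNReal.ofReal (c⁻¹) * energyWeight n m p ∧
      energyWeight n m p ≤ ENNReal.ofReal C * ENNReal.ofReal (dirichletWeight n p) := by
  have : Nonempty (Fin n) := ⟨⟨0, hn⟩⟩
  obtain ⟨N, rfl⟩ : ∃ N, n = N + 1 := ⟨n - 1, by omega⟩
  have hm' : N + 1 < 2 * m := by
    rw [div_lt_iff₀ two_pos] at hm
    have : ((N + 1 : ℕ) : ℝ) < ((2 * m : ℕ) : ℝ) := by push_cast at hm ⊢; linarith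
    exact_mod_cast this
  -- `k = 2m - n - 1` is the Bergman exponent, a natural number because `n < 2m`.
  obtain ⟨k, hk⟩ : ∃ k, 2 * m = N + 1 + k + 1 := ⟨2 * m - N - 2, by omega⟩
  have hs : (2 * (m : ℝ) - (N + 1 : ℕ) - 1) = k := by
    have : (2 * m : ℝ) = N + 1 + k + 1 := by exact_mod_cast hk
    push_cast
    linarith
  obtain ⟨K, hK, hJ⟩ := exists_radialFactor_eq N k
  set τ : ℝ := ((volume : Measure (Cn (N + 1))).toSphere Set.univ).toReal with hτ
  have hT : (volume : Measure (Cn (N + 1))).toSphere Set.univ = ENNReal.ofReal τ :=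
    (ENNReal.ofReal_toReal (measure_ne_top _ _)).symm
  have hτ0 : 0 < τ := by
    refine ENNReal.toReal_pos ?_ (measure_ne_top _ _)
    rw [Ne, Measure.measure_univ_eq_zero]
    exact Measure.toSphere_ne_zero _
  -- `M = 2m - 1`, matching both the factor `p^(2m)` and the factorial in the beta integral.
  set M := N + k + 1 with hM
  have hw : ∀ p, energyWeight (N + 1) m p =
      ENNReal.ofReal (τ * K * (((N + p)! / (p + M)! : ℝ) * p ^ (M + 1))) := by
    intro p
    rw [energyWeight, hs, hJ, hT, ← ENNReal.ofReal_mul hτ0.le, ← ENNReal.ofReal_mul (by positivity),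
      show N + p + k + 1 = p + M by omega, show 2 * m = M + 1 by omega]
    congr 1
    ring
  have hκ : 0 < τ * K := mul_pos hτ0 hK
  refine ⟨τ * K * (N ! / (M + 1 : ℝ) ^ M), τ * K * N !, by positivity, by positivity,
    fun p => ⟨?_, ?_⟩⟩
  · rw [hw, ← ENNReal.ofReal_mul (by positivity)]
    refine ENNReal.ofReal_le_ofReal ?_
    rw [le_inv_mul_iff₀ (by positivity), mul_assoc]
    exact mul_le_mul_of_nonneg_left (dirichletWeight_le_factorial_quotient N M p) hκ.le
  · rw [hw, ← ENNReal.ofReal_mul (by positivity)]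
    refine ENNReal.ofReal_le_ofReal ?_
    rw [mul_assoc (τ * K) (N ! : ℝ)]
    exact mul_le_mul_of_nonneg_left (factorial_quotient_le_dirichletWeight N M p) hκ.le

/-! ### Linearity of the pluriharmonic condition -/

section Pluriharmonic

variable {n : ℕ} {f g : Cn n → ℂ}

lemma wirtinger_congr {j : Fin n} {z : Cn n} (h : f =ᶠ[𝓝 z] g) :
    wirtinger n j f z = wirtinger n j g z := by
  rw [wirtinger, wirtinger, h.fderiv_eq]

lemma wirtinger_add {j : Fin n} {z : Cn n} (hf : DifferentiableAt ℝ f z)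
    (hg : DifferentiableAt ℝ g z) :
    wirtinger n j (f + g) z = wirtinger n j f z + wirtinger n j g z := by
  simp only [wirtinger, fderiv_add hf hg, add_apply]
  ring

lemma wirtingerBar_add {j : Fin n} {z : Cn n} (hf : DifferentiableAt ℝ f z)
    (hg : DifferentiableAt ℝ g z) :
    wirtingerBar n j (f + g) z = wirtingerBar n j f z + wirtingerBar n j g z := by
  simp only [wirtingerBar, fderiv_add hf hg, add_apply]
  ring

lemma wirtinger_const_smul {j : Fin n} {z : Cn n} (hf : DifferentiableAt ℝ f z) (c : ℂ) :
    wirtinger n j (c • f) z = c * wirtinger n j f z := by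
  simp only [wirtinger, fderiv_const_smul hf, smul_apply, smul_eq_mul]
  ring

lemma wirtingerBar_const_smul {j : Fin n} {z : Cn n} (hf : DifferentiableAt ℝ f z) (c : ℂ) :
    wirtingerBar n j (c • f) z = c * wirtingerBar n j f z := by
  simp only [wirtingerBar, fderiv_const_smul hf, smul_apply, smul_eq_mul]
  ring

lemma ContDiffOn.differentiableAt_unitBall (hf : ContDiffOn ℝ 2 f (unitBall n)) {z : Cn n}
    (hz : z ∈ unitBall n) : DifferentiableAt ℝ f z :=
  (hf.contDiffAt (Metric.isOpen_ball.mem_nhds hz)).differentiableAt two_ne_zero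

lemma ContDiffOn.differentiableAt_wirtingerBar (hf : ContDiffOn ℝ 2 f (unitBall n)) {z : Cn n}
    (hz : z ∈ unitBall n) (k : Fin n) : DifferentiableAt ℝ (wirtingerBar n k f) z := by
  have h1 : DifferentiableAt ℝ (fderiv ℝ f) z :=
    ((hf.contDiffAt (Metric.isOpen_ball.mem_nhds hz)).fderiv_right (m := 1)
      (by norm_num)).differentiableAt one_ne_zero
  have h2 : ∀ v, DifferentiableAt ℝ (fun z => fderiv ℝ f z v) z := fun v =>
    h1.clm_apply (differentiableAt_const v)
  exact ((h2 _).add ((h2 _).const_mul Complex.I)).mul_const (2 : ℂ)⁻¹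

lemma IsPluriharmonic.add (hf : IsPluriharmonic n f) (hg : IsPluriharmonic n g) :
    IsPluriharmonic n (f + g) := by
  refine ⟨hf.1.add hg.1, fun z hz j k => ?_⟩
  have h1 : wirtingerBar n k (f + g) =ᶠ[𝓝 z] wirtingerBar n k f + wirtingerBar n k g := by
    filter_upwards [Metric.isOpen_ball.mem_nhds hz] with w hw
    exact wirtingerBar_add (hf.1.differentiableAt_unitBall hw) (hg.1.differentiableAt_unitBall hw)
  rw [wirtinger_congr h1, wirtinger_add (hf.1.differentiableAt_wirtingerBar hz k)
    (hg.1.differentiableAt_wirtingerBar hz k), hf.2 z hz, hg.2 z hz, add_zero]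

lemma IsPluriharmonic.const_smul (hf : IsPluriharmonic n f) (c : ℂ) :
    IsPluriharmonic n (c • f) := by
  refine ⟨hf.1.const_smul c, fun z hz j k => ?_⟩
  have h1 : wirtingerBar n k (c • f) =ᶠ[𝓝 z] c • wirtingerBar n k f := by
    filter_upwards [Metric.isOpen_ball.mem_nhds hz] with w hw
    exact wirtingerBar_const_smul (hf.1.differentiableAt_unitBall hw) c
  rw [wirtinger_congr h1, wirtinger_const_smul (hf.1.differentiableAt_wirtingerBar hz k),
    hf.2 z hz, mul_zero]

lemma isPluriharmonic_zero : IsPluriharmonic n 0 := by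
  have h : ∀ k, wirtingerBar n k (0 : Cn n → ℂ) = 0 := fun k => by
    funext z
    simp [wirtingerBar]
  refine ⟨contDiffOn_const, fun z _ j k => ?_⟩
  rw [h]
  simp [wirtinger]

end Pluriharmonic

/-! ### Seminorms and the equivalence -/

section Seminorms

variable {n : ℕ} {f g : Cn n → ℂ}

/-- `q` is a quadratic functional of the Peter-Weyl components, with given weights. -/
def IsWeightedNormSq (n : ℕ) (q : (Cn n → ℂ) → ℝ≥0∞) : Prop :=
  ∃ a, ∀ f u v, IsPluriharmonic n f → IsPeterWeyl n f u v → q f = weightedNormSq n a u v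

lemma isWeightedNormSq_dirichletNormSq (n : ℕ) : IsWeightedNormSq n (dirichletNormSq n) :=
  ⟨_, fun _ _ _ hf H => dirichletNormSq_eq H hf.1.continuousOn⟩

lemma isWeightedNormSq_radialEnergy (hn : 1 ≤ n) (m : ℕ) :
    IsWeightedNormSq n (radialEnergy n m) :=
  ⟨_, fun _ _ _ hf H => radialEnergy_eq hn m hf H⟩

lemma IsPluriharmonic.exists_isPeterWeyl (hf : IsPluriharmonic n f) :
    ∃ u v, IsPeterWeyl n f u v := by
  obtain ⟨h, k, H⟩ := hf.exists_isHolAddConj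
  exact ⟨_, _, H.isPeterWeyl⟩

lemma IsWeightedNormSq.add_le {q : (Cn n → ℂ) → ℝ≥0∞} (hq : IsWeightedNormSq n q)
    (hf : IsPluriharmonic n f) (hg : IsPluriharmonic n g) {t : ℝ} (ht : 0 < t) :
    q (f + g) ≤ ENNReal.ofReal (1 + t) * q f + ENNReal.ofReal (1 + t⁻¹) * q g := by
  obtain ⟨a, ha⟩ := hq
  obtain ⟨u, v, H⟩ := hf.exists_isPeterWeyl
  obtain ⟨u', v', H'⟩ := hg.exists_isPeterWeyl
  rw [ha _ _ _ hf H, ha _ _ _ hg H', ha _ _ _ (hf.add hg) (H.add H')]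
  exact weightedNormSq_add_le a H ht

lemma IsWeightedNormSq.const_smul {q : (Cn n → ℂ) → ℝ≥0∞} (hq : IsWeightedNormSq n q)
    (hf : IsPluriharmonic n f) (c : ℂ) : q (c • f) = ‖c‖ₑ ^ 2 * q f := by
  obtain ⟨a, ha⟩ := hq
  obtain ⟨u, v, H⟩ := hf.exists_isPeterWeyl
  rw [ha _ _ _ hf H, ha _ _ _ (hf.const_smul c) (H.const_smul c)]
  exact weightedNormSq_const_smul a c u v

/-- For positive `A`, `B` the right side is minimal at `t = √B/√A`, with value `(√A + √B)²`. -/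
lemma sqrt_le_sqrt_add_sqrt_of_forall {A B C : ℝ}
    (h : ∀ t > 0, C ≤ (1 + t) * A + (1 + t⁻¹) * B) : √C ≤ √A + √B := by
  refine le_of_forall_pos_le_add fun ε hε => Real.sqrt_le_iff.2 ⟨by positivity, ?_⟩
  -- The shift by `ε / 2` keeps `t = b / a` defined and positive when `A` or `B` is zero.
  set a := √A + ε / 2 with ha
  set b := √B + ε / 2 with hb
  have ha0 : 0 < a := by positivity
  have hb0 : 0 < b := by positivity
  have hA' : A ≤ a ^ 2 := (Real.sqrt_le_left ha0.le).1 (by linarith)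
  have hB' : B ≤ b ^ 2 := (Real.sqrt_le_left hb0.le).1 (by linarith)
  calc C ≤ (1 + b / a) * A + (1 + (b / a)⁻¹) * B := h _ (by positivity)
    _ ≤ (1 + b / a) * a ^ 2 + (1 + (b / a)⁻¹) * b ^ 2 := by gcongr
    _ = (a + b) ^ 2 := by field_simp; ring
    _ = (√A + √B + ε) ^ 2 := by rw [ha, hb]; ring

lemma IsWeightedNormSq.exists_seminorm {q : (Cn n → ℂ) → ℝ≥0∞} (hq : IsWeightedNormSq n q)
    (V : Submodule ℂ (Cn n → ℂ)) (hV : ∀ f ∈ V, IsPluriharmonic n f) (hfin : ∀ f ∈ V, q f ≠ ⊤) :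
    ∃ D : Seminorm ℂ V, ∀ f : V, D f = √(q f).toReal := by
  refine ⟨Seminorm.of (fun f : V => √(q f).toReal) (fun f g => ?_) (fun c f => ?_), fun f => rfl⟩
  · refine sqrt_le_sqrt_add_sqrt_of_forall fun t ht => ?_
    have h1 := hq.add_le (hV f f.2) (hV g g.2) ht
    have hf := hfin f f.2
    have hg := hfin g g.2
    have h2 := ENNReal.toReal_mono (by finiteness) h1
    rwa [ENNReal.toReal_add (by finiteness) (by finiteness), ENNReal.toReal_mul,
      ENNReal.toReal_mul, ENNReal.toReal_ofReal (by positivity),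
      ENNReal.toReal_ofReal (by positivity)] at h2
  · rw [Submodule.coe_smul, hq.const_smul (hV f f.2), ENNReal.toReal_mul, ENNReal.toReal_pow,
      toReal_enorm, Real.sqrt_mul (by positivity), Real.sqrt_sq (norm_nonneg _)]

/-- The pluriharmonic Dirichlet space as a submodule of the space of functions. -/
def dirichletSubmodule (n : ℕ) : Submodule ℂ (Cn n → ℂ) where
  carrier := dirichletSpace n
  zero_mem' := by
    refine ⟨isPluriharmonic_zero, ?_⟩
    have h := (isWeightedNormSq_dirichletNormSq n).const_smul isPluriharmonic_zero 0
    rw [zero_smul, enorm_zero, zero_pow two_ne_zero, zero_mul] at h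
    exact h.trans_lt ENNReal.zero_lt_top
  add_mem' := by
    rintro f g ⟨hf, hf'⟩ ⟨hg, hg'⟩
    refine ⟨hf.add hg,
      -- Only finiteness matters here, so `t = 1` suffices.
      ((isWeightedNormSq_dirichletNormSq n).add_le hf hg one_pos).trans_lt ?_⟩
    finiteness
  smul_mem' := by
    rintro c f ⟨hf, hf'⟩
    refine ⟨hf.const_smul c, ?_⟩
    rw [(isWeightedNormSq_dirichletNormSq n).const_smul hf]
    finiteness

lemma exists_energy_comparison {m : ℕ} (hn : 1 ≤ n) (hm : (n : ℝ) / 2 < m) :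
    ∃ c C : ℝ, 0 < c ∧ 0 < C ∧ ∀ f, IsPluriharmonic n f →
      dirichletNormSq n f ≤ ENNReal.ofReal c⁻¹ * radialEnergy n m f ∧
      radialEnergy n m f ≤ ENNReal.ofReal C * dirichletNormSq n f := by
  obtain ⟨c, C, hc, hC, h⟩ := exists_energyWeight_comparison hn hm
  refine ⟨c, C, hc, hC, fun f hf => ?_⟩
  obtain ⟨u, v, H⟩ := hf.exists_isPeterWeyl
  rw [dirichletNormSq_eq H hf.1.continuousOn, radialEnergy_eq hn m hf H]
  exact ⟨weightedNormSq_le_mul (fun p => (h p).1) u v, weightedNormSq_le_mul (fun p => (h p).2) u v⟩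

lemma mem_dirichletSpace_iff {m : ℕ} (hn : 1 ≤ n) (hm : (n : ℝ) / 2 < m)
    (hf : IsPluriharmonic n f) : f ∈ dirichletSpace n ↔ radialEnergy n m f < ⊤ := by
  obtain ⟨c, C, -, -, h⟩ := exists_energy_comparison hn hm
  exact ⟨fun hD => (h f hf).2.trans_lt (ENNReal.mul_lt_top ENNReal.ofReal_lt_top hD.2),
    fun hE => ⟨hf, (h f hf).1.trans_lt (ENNReal.mul_lt_top ENNReal.ofReal_lt_top hE)⟩⟩

end Seminorms

theorem mainTheorem7 (n : ℕ) (hn : 1 ≤ n) :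
    (∀ f : Cn n → ℂ, IsPluriharmonic n f →
      (f ∈ dirichletSpace n ↔ ∃ m : ℕ, (n : ℝ) / 2 < m ∧ radialEnergy n m f < ⊤) ∧
      (f ∈ dirichletSpace n ↔ ∀ m : ℕ, (n : ℝ) / 2 < m → radialEnergy n m f < ⊤)) ∧
    ∃ V : Submodule ℂ (Cn n → ℂ), (V : Set (Cn n → ℂ)) = dirichletSpace n ∧
      ∃ D : Seminorm ℂ V,
        (∀ f : V, D f = Real.sqrt (dirichletNormSq n (f : Cn n → ℂ)).toReal) ∧
        ∀ m : ℕ, (n : ℝ) / 2 < m →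
          ∃ Q : Seminorm ℂ V,
            (∀ f : V, Q f = Real.sqrt (radialEnergy n m (f : Cn n → ℂ)).toReal) ∧
            ∃ c C : ℝ, 0 < c ∧ 0 < C ∧ ∀ f : V, c * D f ≤ Q f ∧ Q f ≤ C * D f := by
  -- `m = n` is an admissible exponent: it witnesses (ii) and is where (iii) gets applied.
  have hn2 : (n : ℝ) / 2 < n := half_lt_self (by exact_mod_cast hn)
  refine ⟨fun f hf => ⟨⟨fun h => ⟨n, hn2, (mem_dirichletSpace_iff hn hn2 hf).1 h⟩, ?_⟩,
    ⟨fun h m hm => (mem_dirichletSpace_iff hn hm hf).1 h,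
      fun h => (mem_dirichletSpace_iff hn hn2 hf).2 (h n hn2)⟩⟩, ?_⟩
  · rintro ⟨m, hm, h⟩
    exact (mem_dirichletSpace_iff hn hm hf).2 h
  have hV : ∀ f ∈ dirichletSubmodule n, IsPluriharmonic n f := fun f hf => hf.1
  obtain ⟨D, hD⟩ := (isWeightedNormSq_dirichletNormSq n).exists_seminorm (dirichletSubmodule n) hV
    fun f hf => hf.2.ne
  refine ⟨dirichletSubmodule n, rfl, D, hD, fun m hm => ?_⟩
  have hfin : ∀ f ∈ dirichletSubmodule n, radialEnergy n m f ≠ ⊤ := fun f hf =>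
    ((mem_dirichletSpace_iff hn hm hf.1).1 hf).ne
  obtain ⟨Q, hQ⟩ := (isWeightedNormSq_radialEnergy hn m).exists_seminorm (dirichletSubmodule n) hV
    hfin
  obtain ⟨c, C, hc, hC, h⟩ := exists_energy_comparison hn hm
  -- The weights compare squared norms, hence the square roots.
  refine ⟨Q, hQ, √c, √C, Real.sqrt_pos.2 hc, Real.sqrt_pos.2 hC, fun f => ?_⟩
  obtain ⟨h1, h2⟩ := h f (hV f f.2)
  have hE := hfin f f.2
  have hD' : dirichletNormSq n f ≠ ⊤ := f.2.2.ne
  have h1' := ENNReal.toReal_mono (by finiteness) h1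
  have h2' := ENNReal.toReal_mono (by finiteness) h2
  rw [ENNReal.toReal_mul, ENNReal.toReal_ofReal (by positivity)] at h1' h2'
  rw [hD, hQ, ← Real.sqrt_mul hc.le, ← Real.sqrt_mul hC.le]
  exact ⟨Real.sqrt_le_sqrt (by rwa [← le_inv_mul_iff₀ hc]), Real.sqrt_le_sqrt h2'⟩
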